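/- Let $\mathbb K$ be a commutative ring containing $\mathbb Q$ and let $\Lambda=\mathbb K[p_1,p_2,p_3,\dots]$ be the ring of symmetric functions over $\mathbb K$, freely generated by the power sums $p_r$. For a partition $\lambda$ let $s_\lambda\in\Lambda$ be the Schur function, and let $c^\mu_{\nu\rho}=\langle s_\mu, s_\nu s_\rho\rangle$ be the Littlewood--Richardson coefficients, where $\langle\cdot,\cdot\rangle$ is the Hall inner product (the bilinear form for which the Schur functions are orthonormal); that is, $s_\nu s_\rho=\sum_\mu c^\mu_{\nu\rho}s_\mu$. For $f\in\Lambda$ and $g=\sum_\lambda c_\lambda p_\lambda$ with $c_\lambda\in\mathbb Q$, the plethysm $f[g]$ is determined by $p_r[g]=\sum_\lambda c_\lambda\, p_{r\lambda_1}p_{r\lambda_2}\cdots$ and by $f\mapsto f[g]$ being a homomorphism of $\mathbb K$-algebras. Call a partition \emph{even} if all columns of its Young diagram have even length, and call a partition $\lambda$ with conjugate $\lambda'$ \emph{threshold} if $\lambda'_i=\lambda_i+1$ for every $i\ge 1$ such that the cell $(i,i)$ belongs to $\lambda$; the empty partition of $0$ is both even and threshold. Then for all integers $h>k\ge 0$,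 $$ s_{(h-k,1^k)}[s_{1^2}] \;=\; \sum_{i=0}^{k}\ \sum_{\substack{\mu\vdash 2h\\ \nu\vdash 2(h-k+i)\text{ even}\\ \rho\vdash 2(k-i)\text{ threshold}}} (-1)^i\, c^\mu_{\nu\rho}\, s_\mu . $$ -/

import Mathlib

noncomputable section

/-- The ring of symmetric functions `Λ = K[p₁, p₂, p₃, …]`, freely generated over `K` by the
power sums; the variable with index `r` is the power sum `p_r`. -/
abbrev SymFun (K : Type*) [CommRing K] : Type _ := MvPolynomial ℕ+ K

namespace SymFun

/-- The power sum `p_r`. -/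
def powerSum (K : Type*) [CommRing K] (r : ℕ+) : SymFun K := MvPolynomial.X r

/-- The complete homogeneous symmetric function `h_n`, written in the power sums by means of
Newton's identities `h_0 = 1` and `n h_n = p_1 h_{n-1} + p_2 h_{n-2} + ⋯ + p_n h_0`. -/
def complete (K : Type*) [CommRing K] [Algebra ℚ K] : ℕ → SymFun K
  | 0 => 1
  | n + 1 => ((n + 1 : ℚ)⁻¹) • ∑ i : Fin (n + 1), powerSum K i.1.succPNat * complete K (n - i.1)

/-- `h_n` for an arbitrary integer index, with `h_n = 0` for `n < 0`. -/
def completeInt (K : Type*) [CommRing K] [Algebra ℚ K] (n : ℤ) : SymFun K :=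
  if 0 ≤ n then complete K n.toNat else 0

/-- The Schur function `s_μ = det (h_{μ_i - i + j})_{1 ≤ i, j ≤ ℓ(μ)}` (Jacobi–Trudi).
Here `μ.rowLen i` is the part `μ_{i+1}` and `μ.colLen 0` is the length `ℓ(μ)`. -/
def schur (K : Type*) [CommRing K] [Algebra ℚ K] (μ : YoungDiagram) : SymFun K :=
  Matrix.det (Matrix.of fun i j : Fin (μ.colLen 0) =>
    completeInt K ((μ.rowLen i : ℤ) - (i : ℤ) + (j : ℤ)))

/-- `p_r[g]` for `g = ∑ c_μ p_μ` with rational coefficients: every `p_m` in `g` is replaced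
by `p_{r m}`. -/
def powerSumPlethysm (K : Type*) [CommRing K] [Algebra ℚ K] (r : ℕ+) (g : SymFun ℚ) : SymFun K :=
  MvPolynomial.map (algebraMap ℚ K) (MvPolynomial.rename (fun m : ℕ+ => r * m) g)

/-- The plethysm `f[g]`, for `f` with coefficients in `K` and `g` with rational coefficients:
`K`-linear and multiplicative in `f`, with the value `p_r[g]` at `f = p_r`. -/
def plethysm {K : Type*} [CommRing K] [Algebra ℚ K] (f : SymFun K) (g : SymFun ℚ) : SymFun K :=
  MvPolynomial.aeval (fun r : ℕ+ => powerSumPlethysm K r g) f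

/-- The coordinates of `f` in the Schur basis: the coefficients `a_μ` with
`f = ∑ a_μ s_μ` (a finite sum). -/
def schurCoeffs {K : Type*} [CommRing K] [Algebra ℚ K] (f : SymFun K) : YoungDiagram →₀ K :=
  Function.invFun (Finsupp.linearCombination K (schur K)) f

/-- The Hall inner product, for which the Schur functions are orthonormal:
`⟨∑ a_μ s_μ, ∑ b_μ s_μ⟩ = ∑ a_μ b_μ`. -/
def hallInner {K : Type*} [CommRing K] [Algebra ℚ K] (f g : SymFun K) : K :=
  (schurCoeffs f).sum fun μ a => a * schurCoeffs g μ

/-- The Littlewood–Richardson coefficient `c^μ_{νρ} = ⟨s_μ, s_ν s_ρ⟩`. -/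
def lrCoeff (K : Type*) [CommRing K] [Algebra ℚ K] (μ ν ρ : YoungDiagram) : K :=
  hallInner (schur K μ) (schur K ν * schur K ρ)

end SymFun

namespace YoungDiagram

theorem cells_subset_of_card_eq {n : ℕ} {μ : YoungDiagram} (h : μ.card = n) :
    μ.cells ⊆ Finset.range n ×ˢ Finset.range n := by
  rintro ⟨i, j⟩ hij
  have hsub : Finset.range (i + 1) ×ˢ Finset.range (j + 1) ⊆ μ.cells := by
    rintro ⟨a, b⟩ hab
    simp only [Finset.mem_product, Finset.mem_range] at hab
    exact μ.up_left_mem (by omega) (by omega) hij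
  have hcard := Finset.card_le_card hsub
  simp only [Finset.card_product, Finset.card_range] at hcard
  have hn : (i + 1) * (j + 1) ≤ n := h ▸ hcard
  simp only [Finset.mem_product, Finset.mem_range]
  constructor <;> nlinarith

theorem finite_card_eq (n : ℕ) : {μ : YoungDiagram | μ.card = n}.Finite := by
  refine Set.Finite.of_finite_image (f := YoungDiagram.cells)
    ((Finset.range n ×ˢ Finset.range n).powerset.finite_toSet.subset ?_) ?_
  · rintro _ ⟨μ, hμ, rfl⟩
    exact Finset.mem_coe.2 (Finset.mem_powerset.2 (cells_subset_of_card_eq hμ))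
  · intro μ _ ν _ h
    exact YoungDiagram.ext h

/-- The finite set of all partitions of `n`, given by their Young diagrams. -/
def partitionsOf (n : ℕ) : Finset YoungDiagram := (finite_card_eq n).toFinset

theorem mem_partitionsOf {n : ℕ} {μ : YoungDiagram} : μ ∈ partitionsOf n ↔ μ.card = n := by
  simp [partitionsOf]

/-- A partition is even if all its columns have even length. -/
def IsEven (μ : YoungDiagram) : Prop := ∀ j : ℕ, Even (μ.colLen j)

/-- A partition `μ` with conjugate `μ'` is threshold if `μ'_i = μ_i + 1` for every diagonal
cell `(i, i)` of `μ`. -/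
def IsThreshold (μ : YoungDiagram) : Prop := ∀ i : ℕ, (i, i) ∈ μ → μ.colLen i = μ.rowLen i + 1

open Classical in
/-- The even partitions of `n`. -/
def evenPartitionsOf (n : ℕ) : Finset YoungDiagram := (partitionsOf n).filter IsEven

open Classical in
/-- The threshold partitions of `n`. -/
def thresholdPartitionsOf (n : ℕ) : Finset YoungDiagram := (partitionsOf n).filter IsThreshold

theorem hook_sorted (a k : ℕ) (ha : 0 < a) : (a :: List.replicate k 1).SortedGE := by
  rw [List.sortedGE_iff_pairwise]
  simp only [List.pairwise_cons, List.mem_replicate, List.pairwise_replicate]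
  exact ⟨fun b hb => by omega, by simp⟩

/-- The hook `(a, 1^k)`, with `a ≥ 1`. -/
def hook (a k : ℕ) (ha : 0 < a) : YoungDiagram :=
  ofRowLens (a :: List.replicate k 1) (hook_sorted a k ha)

/-- The one-column partition `(1^2) = (1, 1)`. -/
def columnTwo : YoungDiagram := ofRowLens [1, 1] (hook_sorted 1 1 Nat.one_pos)

end YoungDiagram

end

noncomputable section

namespace SymFun
open PowerSeries

variable {R : Type*} [CommRing R] [Algebra ℚ R]

theorem succ_mul_complete (K : Type*) [CommRing K] [Algebra ℚ K] (n : ℕ) :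
    ((n : SymFun K) + 1) * complete K (n + 1) =
      ∑ i ∈ Finset.range (n + 1), powerSum K i.succPNat * complete K (n - i) := by
  rw [complete, Finset.sum_range
    (fun i => powerSum K i.succPNat * complete K (n - i)), mul_smul_comm, ← smul_mul_assoc]
  have h : ((n + 1 : ℚ)⁻¹) • ((n : SymFun K) + 1) = 1 := by
    have h2 : ((n : SymFun K) + 1) = algebraMap ℚ (SymFun K) (n + 1) := by simp
    rw [h2, Algebra.smul_def, ← map_mul, inv_mul_cancel₀ (by positivity), map_one]
  rw [h, one_mul]

/-- The generating series `∑ hₙ zⁿ` after the substitution `p_r ↦ a r`. -/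
def completeSeries (a : ℕ+ → R) : R⟦X⟧ :=
  PowerSeries.mk fun n => MvPolynomial.aeval a (complete ℚ n)

/-- The generating series `∑ p_{n+1} zⁿ` after the substitution `p_r ↦ a r`. -/
def powerSumSeries {R : Type*} [CommRing R] (a : ℕ+ → R) : R⟦X⟧ := PowerSeries.mk fun n => a n.succPNat

theorem coeff_completeSeries (a : ℕ+ → R) (n : ℕ) :
    coeff n (completeSeries a) = MvPolynomial.aeval a (complete ℚ n) := coeff_mk _ _

theorem derivative_completeSeries (a : ℕ+ → R) :
    d⁄dX R (completeSeries a) = powerSumSeries a * completeSeries a := by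
  ext n
  rw [coeff_derivative, coeff_mul, coeff_completeSeries,
    Finset.Nat.sum_antidiagonal_eq_sum_range_succ_mk]
  have h := congrArg (MvPolynomial.aeval a) (succ_mul_complete ℚ n)
  simp only [map_mul, map_add, map_natCast, map_one, map_sum] at h
  rw [mul_comm, h]
  refine Finset.sum_congr rfl fun i _ => ?_
  simp [powerSumSeries, coeff_completeSeries, powerSum]

theorem constantCoeff_completeSeries (a : ℕ+ → R) :
    constantCoeff (completeSeries a) = 1 := by
  rw [← coeff_zero_eq_constantCoeff_apply, coeff_completeSeries, complete, map_one]

theorem eq_completeSeries {a : ℕ+ → R} {G : R⟦X⟧} (h0 : constantCoeff G = 1)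
    (hG : d⁄dX R G = powerSumSeries a * G) : G = completeSeries a := by
  ext n
  induction n using Nat.strong_induction_on with
  | _ n ih =>
    rcases n with _ | n
    · simpa [constantCoeff_completeSeries] using h0
    · have h1 := congrArg (coeff n) hG
      have h2 := congrArg (coeff n) (derivative_completeSeries a)
      rw [coeff_derivative, coeff_mul] at h1 h2
      have h3 : coeff (n + 1) G * ((n : R) + 1) =
          coeff (n + 1) (completeSeries a) * ((n : R) + 1) := by
        rw [h1, h2]
        refine Finset.sum_congr rfl fun p hp => ?_
        rw [ih p.2 (by have := Finset.HasAntidiagonal.mem_antidiagonal.1 hp; omega)]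
      have h4 : ((n : R) + 1) * algebraMap ℚ R ((n + 1 : ℚ)⁻¹) = 1 := by
        have : ((n : R) + 1) = algebraMap ℚ R (n + 1) := by simp
        rw [this, ← map_mul, mul_inv_cancel₀ (by positivity), map_one]
      calc _ = coeff (n + 1) G * ((n : R) + 1) * algebraMap ℚ R ((n + 1 : ℚ)⁻¹) := by
            rw [mul_assoc, h4, mul_one]
        _ = _ := by rw [h3, mul_assoc, h4, mul_one]

theorem powerSumSeries_add {R : Type*} [CommRing R] (a b : ℕ+ → R) :
    powerSumSeries (a + b) = powerSumSeries a + powerSumSeries b := by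
  ext n; simp [powerSumSeries]

theorem completeSeries_add (a b : ℕ+ → R) :
    completeSeries (a + b) = completeSeries a * completeSeries b := by
  symm
  apply eq_completeSeries
  · simp [constantCoeff_completeSeries]
  · rw [Derivation.leibniz, derivative_completeSeries, derivative_completeSeries,
      powerSumSeries_add, smul_eq_mul, smul_eq_mul]
    ring

theorem completeSeries_zero : completeSeries (0 : ℕ+ → R) = 1 := by
  symm
  apply eq_completeSeries
  · simp
  · have : powerSumSeries (0 : ℕ+ → R) = 0 := by ext n; simp [powerSumSeries]
    rw [this, zero_mul]
    exact derivative_one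

theorem completeSeries_sum {ι : Type*} (s : Finset ι) (a : ι → ℕ+ → R) :
    completeSeries (∑ i ∈ s, a i) = ∏ i ∈ s, completeSeries (a i) := by
  classical
  induction s using Finset.induction_on with
  | empty => simp [completeSeries_zero]
  | insert i s hi ih => rw [Finset.sum_insert hi, Finset.prod_insert hi, completeSeries_add, ih]

theorem completeSeries_smul (s : R) (a : ℕ+ → R) :
    completeSeries (fun r => s ^ (r : ℕ) * a r) = rescale s (completeSeries a) := by
  symm
  apply eq_completeSeries
  · rw [← coeff_zero_eq_constantCoeff_apply, coeff_rescale, coeff_zero_eq_constantCoeff_apply,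
      constantCoeff_completeSeries]
    simp
  · ext n
    have h2 := congrArg (coeff n) (derivative_completeSeries a)
    rw [coeff_derivative, coeff_mul] at h2 ⊢
    rw [coeff_rescale, mul_assoc, h2, Finset.mul_sum]
    refine Finset.sum_congr rfl fun p hp => ?_
    have := Finset.HasAntidiagonal.mem_antidiagonal.1 hp
    rw [coeff_rescale, ← this]
    simp only [powerSumSeries, coeff_mk, Nat.succPNat_coe, Nat.succ_eq_add_one]
    ring

theorem completeSeries_neg_mul (a : ℕ+ → R) : completeSeries (-a) * completeSeries a = 1 := by
  rw [← completeSeries_add, neg_add_cancel, completeSeries_zero]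

theorem completeSeries_pow (t : R) :
    completeSeries (fun r => t ^ (r : ℕ)) = PowerSeries.mk (fun n => t ^ n) := by
  symm
  apply eq_completeSeries
  · rw [← coeff_zero_eq_constantCoeff_apply, coeff_mk, pow_zero]
  · ext n
    rw [coeff_derivative, coeff_mul, Finset.sum_congr rfl (g := fun _ => t ^ (n + 1))]
    · simp [mul_comm]
    · intro p hp
      have := Finset.HasAntidiagonal.mem_antidiagonal.1 hp
      simp only [powerSumSeries, coeff_mk, Nat.succPNat_coe, Nat.succ_eq_add_one]
      rw [← pow_add, ← this]
      congr 1; omega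

theorem completeSeries_pow_mul (t : R) :
    completeSeries (fun r => t ^ (r : ℕ)) * (1 - C t * X) = 1 := by
  rw [completeSeries_pow]
  ext n
  rcases n with _ | n
  · simp [mul_sub]
  · rw [mul_sub, mul_one, map_sub, ← mul_assoc, coeff_succ_mul_X, mul_comm, coeff_C_mul]
    simp [coeff_one, pow_succ, mul_comm]

/-- The elementary symmetric function `e_n`, the image of `h_n` under `p_r ↦ (-1)^(r-1) p_r`. -/
def elementary (n : ℕ) : SymFun ℚ :=
  MvPolynomial.aeval (fun r : ℕ+ => (-1) ^ ((r : ℕ) + 1) * powerSum ℚ r) (complete ℚ n)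

theorem aeval_elementary (a : ℕ+ → R) (n : ℕ) :
    MvPolynomial.aeval a (elementary n) =
      coeff n (completeSeries (fun r : ℕ+ => (-1) ^ ((r : ℕ) + 1) * a r)) := by
  rw [coeff_completeSeries, elementary, ← AlgHom.comp_apply]
  congr 1
  apply MvPolynomial.algHom_ext
  intro r
  simp [powerSum]

theorem completeSeries_pow_elementary (t : R) :
    completeSeries (fun r : ℕ+ => (-1) ^ ((r : ℕ) + 1) * t ^ (r : ℕ)) = 1 + C t * X := by
  have h1 := completeSeries_pow_mul (-t)
  have h2 := completeSeries_neg_mul (fun r : ℕ+ => (-t) ^ (r : ℕ))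
  have h3 : (-fun r : ℕ+ => (-t) ^ (r : ℕ)) = fun r : ℕ+ => (-1) ^ ((r : ℕ) + 1) * t ^ (r : ℕ) := by
    funext r
    simp only [Pi.neg_apply]
    rw [neg_pow t, pow_succ]; ring
  rw [h3] at h2
  calc _ = completeSeries (fun r : ℕ+ => (-1) ^ ((r : ℕ) + 1) * t ^ (r : ℕ)) *
        (completeSeries (fun r : ℕ+ => (-t) ^ (r : ℕ)) * (1 - C (-t) * X)) := by rw [h1, mul_one]
    _ = _ := by rw [← mul_assoc, h2]; simp

theorem sum_complete_mul_elementary (n : ℕ) (hn : 0 < n) :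
    ∑ p ∈ Finset.HasAntidiagonal.antidiagonal n, (-1) ^ p.2 * complete ℚ p.1 * elementary p.2 = 0 := by
  have h1 := completeSeries_neg_mul (fun r : ℕ+ => (-1) ^ (r : ℕ) * powerSum ℚ r)
  have h3 : (-fun r : ℕ+ => (-1) ^ (r : ℕ) * powerSum ℚ r) =
      fun r : ℕ+ => (-1) ^ ((r : ℕ) + 1) * powerSum ℚ r := by
    funext r
    simp only [Pi.neg_apply]
    rw [pow_succ]; ring
  rw [h3, completeSeries_smul (-1) (fun r => powerSum ℚ r)] at h1
  have h4 := congrArg (rescale (-1 : SymFun ℚ)) h1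
  have h5 := congrArg (coeff n) h4
  rw [map_mul, rescale_rescale, neg_mul_neg, one_mul, rescale_one, map_one, coeff_mul, coeff_one,
    if_neg hn.ne', ← Finset.Nat.sum_antidiagonal_swap] at h5
  rw [← h5]
  refine Finset.sum_congr rfl fun p _ => ?_
  rw [coeff_rescale, ← aeval_elementary, RingHom.id_apply, coeff_completeSeries]
  have h6 : MvPolynomial.aeval (fun r => powerSum ℚ r) = AlgHom.id ℚ (SymFun ℚ) := by
    apply MvPolynomial.algHom_ext
    intro r
    simp [powerSum]
  simp only [Prod.fst_swap, Prod.snd_swap]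
  rw [h6]
  simp only [AlgHom.id_apply]
  ring

end SymFun

namespace SymFun
open PowerSeries

theorem map_complete (K : Type*) [CommRing K] [Algebra ℚ K] (n : ℕ) :
    MvPolynomial.map (algebraMap ℚ K) (complete ℚ n) = complete K n := by
  have h := congrArg (coeff n) (eq_completeSeries (R := SymFun K) (a := powerSum K)
    (G := PowerSeries.mk (complete K)) ?_ ?_)
  · rw [coeff_mk, coeff_completeSeries] at h
    rw [h]
    generalize complete ℚ n = f
    induction f using MvPolynomial.induction_on with
    | C a =>
      rw [MvPolynomial.map_C, MvPolynomial.aeval_C]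
      rfl
    | add p q hp hq => rw [map_add, map_add, hp, hq]
    | mul_X p i hp => rw [map_mul, map_mul, hp]; simp [powerSum]
  · rw [← coeff_zero_eq_constantCoeff_apply, coeff_mk, complete]
  · ext n
    rw [coeff_derivative, coeff_mul, coeff_mk, mul_comm, succ_mul_complete,
      Finset.Nat.sum_antidiagonal_eq_sum_range_succ_mk]
    simp [powerSumSeries]

theorem map_schur (K : Type*) [CommRing K] [Algebra ℚ K] (μ : YoungDiagram) :
    MvPolynomial.map (algebraMap ℚ K) (schur ℚ μ) = schur K μ := by
  rw [schur, schur, RingHom.map_det]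
  congr 1
  ext i j : 1
  simp only [RingHom.mapMatrix_apply, Matrix.map_apply, Matrix.of_apply, completeInt]
  split_ifs
  · exact map_complete K _
  · simp

theorem completeInt_natCast (n : ℕ) : completeInt ℚ n = complete ℚ n := by simp [completeInt]

theorem completeInt_of_neg {n : ℤ} (hn : n < 0) : completeInt ℚ n = 0 := by
  simp [completeInt, hn.not_ge]

/-- The Jacobi–Trudi determinant of size `n` with row lengths `f`. -/
def jacobiTrudi (f : ℕ → ℕ) (n : ℕ) : SymFun ℚ :=
  Matrix.det (Matrix.of fun i j : Fin n => completeInt ℚ ((f i : ℤ) - (i : ℤ) + (j : ℤ)))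

theorem jacobiTrudi_succ {f : ℕ → ℕ} {n : ℕ} (hf : f n = 0) :
    jacobiTrudi f (n + 1) = jacobiTrudi f n := by
  rw [jacobiTrudi, Matrix.det_succ_row _ (Fin.last n), Finset.sum_eq_single (Fin.last n)]
  · rw [jacobiTrudi]
    have h1 : completeInt ℚ 0 = 1 := by simp [completeInt, complete]
    simp only [Matrix.of_apply, Fin.val_last, hf, Nat.cast_zero, zero_sub, neg_add_cancel, h1,
      mul_one, ← two_mul, pow_mul, neg_one_sq, one_pow, one_mul]
    congr 1
    ext i j : 1
    simp
  · intro j _ hj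
    have : (j : ℕ) < n := Fin.val_lt_last hj
    rw [Matrix.of_apply, completeInt_of_neg]
    · simp
    · simp [hf]; omega
  · simp

theorem schur_eq_jacobiTrudi (μ : YoungDiagram) {n : ℕ} (hn : μ.colLen 0 ≤ n) :
    schur ℚ μ = jacobiTrudi μ.rowLen n := by
  induction n, hn using Nat.le_induction with
  | base => rfl
  | succ n hn ih =>
    rw [ih, jacobiTrudi_succ]
    have h : (n, 0) ∉ μ := by rw [YoungDiagram.mem_iff_lt_colLen]; omega
    rw [YoungDiagram.mem_iff_lt_rowLen] at h
    omega

variable {R : Type*} [CommRing R] [Algebra ℚ R]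

/-- The value of a symmetric function at finitely many variables. -/
def evalVars {N : ℕ} (x : Fin N → R) : SymFun ℚ →ₐ[ℚ] R :=
  MvPolynomial.aeval fun r : ℕ+ => ∑ i, x i ^ (r : ℕ)

/-- The alternant `det (x_j ^ β_i)`. -/
def alternant {R : Type*} [CommRing R] {N : ℕ} (x : Fin N → R) (β : Fin N → ℕ) : R :=
  Matrix.det (Matrix.of fun i j : Fin N => x j ^ β i)

/-- The exponents `f i + N - 1 - i`. -/
def shifted (N : ℕ) (f : ℕ → ℕ) (i : Fin N) : ℕ := f i + (N - 1 - i)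

theorem evalVars_complete {N : ℕ} (x : Fin N → R) (n : ℕ) :
    evalVars x (complete ℚ n) =
      coeff n (∏ i, completeSeries fun r : ℕ+ => x i ^ (r : ℕ)) := by
  rw [← completeSeries_sum, coeff_completeSeries, evalVars]
  congr 2
  funext r
  simp

theorem sum_complete_mul_coeff {N : ℕ} (x : Fin N → R) (k : Fin N) (b : ℕ) :
    ∑ j : Fin N, evalVars x (completeInt ℚ ((b : ℤ) - (N - 1 : ℕ) + (j : ℤ))) *
      (∏ l ∈ Finset.univ.erase k, (1 - Polynomial.C (x l) * Polynomial.X)).coeff (N - 1 - j) =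
        x k ^ b := by
  set Q : Polynomial R := ∏ l ∈ Finset.univ.erase k, (1 - Polynomial.C (x l) * Polynomial.X) with hQ
  have hdeg : Q.natDegree ≤ N - 1 := by
    refine (Polynomial.natDegree_prod_le _ _).trans ?_
    refine (Finset.sum_le_card_nsmul _ _ 1 fun l _ => ?_).trans ?_
    · compute_degree
    · simp
  have hQ0 : ∀ m, N ≤ m → Q.coeff m = 0 := fun m hm =>
    Polynomial.coeff_eq_zero_of_natDegree_lt (by have := k.pos; omega)
  have hprod : (∏ i, completeSeries fun r : ℕ+ => x i ^ (r : ℕ)) * (Q : R⟦X⟧) =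
      PowerSeries.mk fun n => x k ^ n := by
    rw [← completeSeries_pow, ← Finset.mul_prod_erase _ _ (Finset.mem_univ k), mul_assoc, hQ,
      ← Polynomial.coeToPowerSeries.ringHom_apply, map_prod, ← Finset.prod_mul_distrib]
    rw [Finset.prod_eq_one, mul_one]
    intro l _
    simp only [Polynomial.coeToPowerSeries.ringHom_apply, Polynomial.coe_sub, Polynomial.coe_one,
      Polynomial.coe_mul, Polynomial.coe_C, Polynomial.coe_X]
    exact completeSeries_pow_mul (x l)
  have h1 := congrArg (coeff b) hprod
  rw [coeff_mk, mul_comm, coeff_mul, Finset.Nat.sum_antidiagonal_eq_sum_range_succ_mk] at h1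
  rw [← h1]
  let F : ℕ → R := fun m => evalVars x (completeInt ℚ ((b : ℤ) - m)) * Q.coeff m
  have h2 : ∑ j : Fin N, evalVars x (completeInt ℚ ((b : ℤ) - (N - 1 : ℕ) + (j : ℤ))) *
      Q.coeff (N - 1 - j) = ∑ m ∈ Finset.range N, F m := by
    rw [← Finset.sum_range_reflect, Finset.sum_range]
    refine Finset.sum_congr rfl fun j _ => ?_
    have h3 : (b : ℤ) - (N - 1 : ℕ) + (j : ℤ) = (b : ℤ) - ((N - 1 - j : ℕ) : ℤ) := by
      have := j.2
      omega
    simp only [F]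
    rw [h3]
  rw [h2]
  calc ∑ m ∈ Finset.range N, F m = ∑ m ∈ Finset.range (N + (b + 1)), F m := by
        apply Finset.sum_subset
        · intro m; simp only [Finset.mem_range]; omega
        · intro m _ hm
          simp only [Finset.mem_range, not_lt] at hm
          simp [F, hQ0 m hm]
    _ = ∑ m ∈ Finset.range (b + 1), F m := by
        symm
        apply Finset.sum_subset
        · intro m; simp only [Finset.mem_range]; omega
        · intro m _ hm
          simp only [Finset.mem_range, not_lt] at hm
          simp only [F]
          rw [completeInt_of_neg (by omega)]
          simp
    _ = _ := by
        refine Finset.sum_congr rfl fun m hm => ?_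
        simp only [Finset.mem_range] at hm
        have : ((b : ℤ) - m) = ((b - m : ℕ) : ℤ) := by omega
        simp only [F]
        rw [this, completeInt_natCast, evalVars_complete, Polynomial.coeff_coe]
        ring

theorem alternant_shifted {N : ℕ} (x : Fin N → R) (f : ℕ → ℕ) :
    alternant x (shifted N f) = evalVars x (jacobiTrudi f N) * alternant x (shifted N 0) := by
  let M : Matrix (Fin N) (Fin N) R := Matrix.of fun j k =>
    (∏ l ∈ Finset.univ.erase k, (1 - Polynomial.C (x l) * Polynomial.X)).coeff (N - 1 - j)
  have key : ∀ f : ℕ → ℕ, alternant x (shifted N f) = evalVars x (jacobiTrudi f N) * M.det := by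
    intro f
    rw [jacobiTrudi, AlgHom.map_det, ← Matrix.det_mul, alternant]
    congr 1
    ext i k
    rw [Matrix.mul_apply, Matrix.of_apply, ← sum_complete_mul_coeff]
    refine Finset.sum_congr rfl fun j _ => ?_
    simp only [AlgHom.mapMatrix_apply, Matrix.map_apply, Matrix.of_apply, M, shifted]
    congr 3
    have := i.2
    omega
  have h0 : ∀ n, jacobiTrudi 0 n = 1 := by
    intro n
    induction n with
    | zero => simp [jacobiTrudi]
    | succ n ih => rw [jacobiTrudi_succ rfl, ih]
  rw [key f, key 0, h0, map_one, one_mul]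

theorem alternant_staircase {R : Type*} [CommRing R] {N : ℕ} (x : Fin N → R) :
    alternant x (shifted N 0) = ∏ i : Fin N, ∏ j ∈ Finset.Ioi i, (x i - x j) := by
  have h := Matrix.det_projVandermonde (fun _ => 1) x
  simp only [one_mul] at h
  rw [← h, ← Matrix.det_transpose, alternant]
  congr 1
  ext i j
  simp only [Matrix.of_apply, Matrix.transpose_apply, Matrix.projVandermonde_apply, shifted,
    one_pow, one_mul, Fin.val_rev]
  congr 1
  simp only [Pi.zero_apply]
  omega

end SymFun

namespace YoungDiagram

theorem ext_rowLen {μ ν : YoungDiagram} (h : ∀ i, μ.rowLen i = ν.rowLen i) : μ = ν := by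
  apply YoungDiagram.ext
  ext ⟨i, j⟩
  rw [mem_cells, mem_cells, mem_iff_lt_rowLen, mem_iff_lt_rowLen, h]

theorem rowLen_eq_zero_iff {μ : YoungDiagram} {i : ℕ} : μ.rowLen i = 0 ↔ μ.colLen 0 ≤ i := by
  have h := (mem_iff_lt_rowLen (μ := μ) (i := i) (j := 0)).symm.trans mem_iff_lt_colLen
  omega

theorem lt_colLen_iff {μ : YoungDiagram} {i j : ℕ} : i < μ.colLen j ↔ j < μ.rowLen i := by
  rw [← mem_iff_lt_rowLen, mem_iff_lt_colLen]

/-- The Young diagram with row lengths `f i` for `i < n`. -/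
def ofRows (f : ℕ → ℕ) (n : ℕ) (hf : Antitone f) : YoungDiagram where
  cells := (Finset.range n).sigma (fun i => Finset.range (f i)) |>.map
    (Equiv.sigmaEquivProd ℕ ℕ).toEmbedding
  isLowerSet := by
    rintro ⟨i, j⟩ ⟨i', j'⟩ hle h
    simp only [Prod.mk_le_mk] at hle
    simp only [Finset.coe_map, Set.mem_image, Finset.mem_coe, Finset.mem_sigma, Finset.mem_range,
      Equiv.coe_toEmbedding, Sigma.exists, Equiv.sigmaEquivProd_apply, Prod.mk.injEq] at h ⊢
    obtain ⟨a, b, ⟨h1, h2⟩, rfl, rfl⟩ := h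
    exact ⟨i', j', ⟨by omega, by have := hf hle.1; omega⟩, rfl, rfl⟩

theorem rowLen_ofRows {f : ℕ → ℕ} {n : ℕ} (hf : Antitone f) (hn : f n = 0) (i : ℕ) :
    (ofRows f n hf).rowLen i = f i := by
  have key : ∀ j, j < (ofRows f n hf).rowLen i ↔ j < f i := by
    intro j
    rw [← mem_iff_lt_rowLen, ← mem_cells]
    simp only [ofRows, Finset.mem_map, Finset.mem_sigma, Finset.mem_range,
      Equiv.coe_toEmbedding, Sigma.exists, Equiv.sigmaEquivProd_apply, Prod.mk.injEq]
    constructor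
    · rintro ⟨a, b, ⟨_, h⟩, rfl, rfl⟩; exact h
    · intro h
      refine ⟨i, j, ⟨?_, h⟩, rfl, rfl⟩
      by_contra hc
      have := hf (not_lt.1 hc)
      omega
  have h1 := key (f i)
  have h2 := key ((ofRows f n hf).rowLen i)
  omega

theorem card_eq_sum_rowLen (μ : YoungDiagram) {n : ℕ} (hn : μ.colLen 0 ≤ n) :
    μ.card = ∑ i ∈ Finset.range n, μ.rowLen i := by
  have : μ.cells = (Finset.range n).biUnion μ.row := by
    ext ⟨i, j⟩
    simp only [Finset.mem_biUnion, Finset.mem_range, mem_row_iff, mem_cells]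
    constructor
    · intro h
      refine ⟨i, ?_, h, rfl⟩
      have h2 := mem_iff_lt_rowLen.1 h
      by_contra hc
      have := rowLen_eq_zero_iff.2 (hn.trans (not_lt.1 hc))
      omega
    · rintro ⟨_, _, h, rfl⟩; exact h
  rw [YoungDiagram.card, this, Finset.card_biUnion]
  · simp [rowLen_eq_card]
  · intro i _ i' _ hne
    rw [Function.onFun, Finset.disjoint_left]
    intro c h1 h2
    rw [mem_row_iff] at h1 h2
    exact hne (h1.2.symm.trans h2.2)

theorem colLen_zero_le_card (μ : YoungDiagram) : μ.colLen 0 ≤ μ.card := by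
  rw [colLen_eq_card]
  exact Finset.card_le_card (Finset.filter_subset _ _)

end YoungDiagram

namespace SymFun
open MvPolynomial

theorem strictAnti_shifted (N : ℕ) {f : ℕ → ℕ} (hf : Antitone f) : StrictAnti (shifted N f) := by
  intro i j hij
  have h1 := hf (show (i : ℕ) ≤ j from hij.le)
  have h2 : (i : ℕ) < j := hij
  have h3 := j.2
  simp only [shifted]
  omega

theorem coeff_alternant {N : ℕ} {β γ : Fin N → ℕ} (hβ : StrictAnti β) (hγ : StrictAnti γ) :
    coeff (Finsupp.equivFunOnFinite.symm γ) (alternant (X : Fin N → MvPolynomial (Fin N) ℚ) β) =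
      if β = γ then 1 else 0 := by
  have hmon : ∀ σ : Equiv.Perm (Fin N), ∏ i, (X (σ i) : MvPolynomial (Fin N) ℚ) ^ β i =
      monomial (Finsupp.equivFunOnFinite.symm (fun j => β (σ.symm j))) 1 := by
    intro σ
    rw [monomial_eq, map_one, one_mul, Finsupp.prod_fintype _ _ (by simp),
      ← Equiv.prod_comp σ (fun j => X j ^ _)]
    simp
  have hperm : ∀ σ : Equiv.Perm (Fin N), (fun j => β (σ.symm j)) = γ → σ = 1 := by
    intro σ h
    have h1 : StrictMono (σ.symm : Fin N → Fin N) := by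
      intro i j hij
      have := hγ hij
      rw [← h] at this
      exact hβ.lt_iff_gt.1 this
    have h2 : (σ.symm : Fin N → Fin N) = id := by
      have := Subsingleton.elim (h1.orderIsoOfSurjective _ σ.symm.surjective) (OrderIso.refl _)
      funext i
      exact congrArg (fun e : Fin N ≃o Fin N => e i) this
    ext i
    have := congrFun h2 (σ i)
    simp only [Equiv.symm_apply_apply, id] at this
    simp [← this]
  rw [alternant, ← Matrix.det_transpose, Matrix.det_apply, coeff_sum,
    Finset.sum_eq_single 1]
  · simp only [Equiv.Perm.sign_one, one_smul, Matrix.transpose_apply, Matrix.of_apply]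
    rw [hmon 1, coeff_monomial]
    have h1 : (fun j => β ((1 : Equiv.Perm (Fin N)).symm j)) = β := rfl
    simp only [h1, EmbeddingLike.apply_eq_iff_eq]
  · intro σ _ hσ
    simp only [Matrix.transpose_apply, Matrix.of_apply]
    rw [hmon σ, Units.smul_def, coeff_smul, coeff_monomial, if_neg, smul_zero]
    intro h
    exact hσ (hperm σ (Finsupp.equivFunOnFinite.symm.injective h))
  · simp

/-- Evaluation at `N` independent variables. -/
def evalX (N : ℕ) : SymFun ℚ →ₐ[ℚ] MvPolynomial (Fin N) ℚ := evalVars X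

theorem alternant_X_ne_zero (N : ℕ) :
    alternant (X : Fin N → MvPolynomial (Fin N) ℚ) (shifted N 0) ≠ 0 := by
  intro h
  have h0 : Antitone (0 : ℕ → ℕ) := fun _ _ _ => le_rfl
  have := coeff_alternant (strictAnti_shifted N h0) (strictAnti_shifted N h0)
  simp [h] at this

theorem evalX_schur_mul {N : ℕ} {μ : YoungDiagram} (h : μ.colLen 0 ≤ N) :
    evalX N (schur ℚ μ) * alternant X (shifted N 0) = alternant X (shifted N μ.rowLen) := by
  rw [alternant_shifted X μ.rowLen, schur_eq_jacobiTrudi μ h, evalX]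

theorem shifted_rowLen_inj {N : ℕ} {μ ν : YoungDiagram} (hμ : μ.colLen 0 ≤ N)
    (hν : ν.colLen 0 ≤ N) (h : shifted N μ.rowLen = shifted N ν.rowLen) : μ = ν := by
  apply YoungDiagram.ext_rowLen
  intro i
  by_cases hi : i < N
  · have := congrFun h ⟨i, hi⟩
    simp only [shifted] at this
    omega
  · rw [YoungDiagram.rowLen_eq_zero_iff.2 (hμ.trans (not_lt.1 hi)),
      YoungDiagram.rowLen_eq_zero_iff.2 (hν.trans (not_lt.1 hi))]

theorem eq_zero_of_evalX_linearCombination {N : ℕ} {l : YoungDiagram →₀ ℚ}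
    (hN : ∀ μ ∈ l.support, μ.colLen 0 ≤ N)
    (hl : evalX N (Finsupp.linearCombination ℚ (schur ℚ) l) = 0) : l = 0 := by
  ext μ
  by_contra hμ
  have hμs : μ ∈ l.support := Finsupp.mem_support_iff.2 hμ
  have h1 := congrArg (fun f => coeff (Finsupp.equivFunOnFinite.symm (shifted N μ.rowLen))
    (f * alternant X (shifted N 0))) hl
  simp only [zero_mul, coeff_zero] at h1
  rw [Finsupp.linearCombination_apply, Finsupp.sum, map_sum, Finset.sum_mul, coeff_sum,
    Finset.sum_eq_single μ] at h1
  · rw [map_smul, smul_mul_assoc, evalX_schur_mul (hN μ hμs), coeff_smul,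
      coeff_alternant (strictAnti_shifted N μ.rowLen_anti) (strictAnti_shifted N μ.rowLen_anti)] at h1
    simp at h1
    exact hμ h1
  · intro ν hν hne
    rw [map_smul, smul_mul_assoc, evalX_schur_mul (hN ν hν), coeff_smul,
      coeff_alternant (strictAnti_shifted N ν.rowLen_anti) (strictAnti_shifted N μ.rowLen_anti),
      if_neg, smul_zero]
    exact fun h => hne (shifted_rowLen_inj (hN ν hν) (hN μ hμs) h)
  · exact fun h => absurd hμs h

theorem linearIndependent_schur : LinearIndependent ℚ (schur ℚ) := by
  rw [linearIndependent_iff]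
  intro l hl
  apply eq_zero_of_evalX_linearCombination (N := l.support.sup fun μ => μ.colLen 0)
  · intro μ hμ
    exact Finset.le_sup (f := fun μ : YoungDiagram => μ.colLen 0) hμ
  · rw [hl, map_zero]

end SymFun

namespace SymFun
open MvPolynomial

/-- The grading of `Λ` with `p_r` in degree `r`. -/
def degreeWeight (r : ℕ+) : ℤ := (r : ℕ)

theorem homogeneous_powerSum (r : ℕ+) :
    IsWeightedHomogeneous degreeWeight (powerSum ℚ r) (r : ℕ) :=
  isWeightedHomogeneous_X ℚ degreeWeight r

theorem homogeneous_complete (n : ℕ) :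
    IsWeightedHomogeneous degreeWeight (complete ℚ n) (n : ℤ) := by
  induction n using Nat.strong_induction_on with
  | _ n ih =>
    rcases n with _ | n
    · rw [complete]; exact isWeightedHomogeneous_one ℚ degreeWeight
    · rw [complete]
      refine (weightedHomogeneousSubmodule ℚ degreeWeight _).smul_mem _
        (Submodule.sum_mem _ fun i _ => ?_)
      have h := (homogeneous_powerSum i.1.succPNat).mul (ih (n - i.1) (by omega))
      rw [mem_weightedHomogeneousSubmodule]
      have h2 : ((n + 1 : ℕ) : ℤ) = ((i.1.succPNat : ℕ) : ℤ) + ((n - i.1 : ℕ) : ℤ) := by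
        have := i.2
        rw [Nat.succPNat_coe]
        omega
      rw [h2]
      exact h

theorem homogeneous_completeInt (n : ℤ) :
    IsWeightedHomogeneous degreeWeight (completeInt ℚ n) n := by
  rcases le_or_gt 0 n with h | h
  · lift n to ℕ using h
    rw [completeInt_natCast]
    exact homogeneous_complete n
  · rw [completeInt_of_neg h]
    exact isWeightedHomogeneous_zero ℚ degreeWeight n

theorem homogeneous_schur (μ : YoungDiagram) :
    IsWeightedHomogeneous degreeWeight (schur ℚ μ) (μ.card : ℤ) := by
  rw [schur, Matrix.det_apply]
  refine (Submodule.sum_mem (weightedHomogeneousSubmodule ℚ degreeWeight _) fun σ _ => ?_)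
  rw [Units.smul_def]
  refine Submodule.smul_of_tower_mem _ _ ?_
  rw [mem_weightedHomogeneousSubmodule]
  have h := IsWeightedHomogeneous.prod (w := degreeWeight) Finset.univ
    (fun i : Fin (μ.colLen 0) => completeInt ℚ ((μ.rowLen (σ i) : ℤ) - (σ i : ℕ) + (i : ℕ)))
    (fun i => (μ.rowLen (σ i) : ℤ) - (σ i : ℕ) + (i : ℕ))
    (fun i _ => homogeneous_completeInt _)
  suffices h2 : (μ.card : ℤ) =
      ∑ i : Fin (μ.colLen 0), ((μ.rowLen (σ i) : ℤ) - (σ i : ℕ) + (i : ℕ)) by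
    rw [h2]
    exact h
  rw [Finset.sum_add_distrib, Finset.sum_sub_distrib,
    Equiv.sum_comp σ (fun i => (μ.rowLen i : ℤ)), Equiv.sum_comp σ (fun i : Fin _ => ((i : ℕ) : ℤ)),
    YoungDiagram.card_eq_sum_rowLen μ le_rfl, Finset.sum_range]
  push_cast
  ring

/-- Row lengths of the conjugate of the partition with `d r` parts equal to `r`. -/
def conjugateRows (d : ℕ+ →₀ ℕ) (j : ℕ) : ℕ := ∑ r ∈ d.support, if j < (r : ℕ) then d r else 0

theorem antitone_conjugateRows (d : ℕ+ →₀ ℕ) : Antitone (conjugateRows d) := by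
  intro i j hij
  refine Finset.sum_le_sum fun r _ => ?_
  split_ifs <;> omega

theorem conjugateRows_sub (d : ℕ+ →₀ ℕ) (r : ℕ+) :
    conjugateRows d (r - 1) = conjugateRows d r + d r := by
  have hr := r.pos
  have h : d r = ∑ s ∈ d.support, if s = r then d s else 0 := by
    rw [Finset.sum_ite_eq']
    split_ifs with h
    · rfl
    · exact Finsupp.notMem_support_iff.1 h
  rw [conjugateRows, conjugateRows]
  conv_rhs => rw [h]
  rw [← Finset.sum_add_distrib]
  refine Finset.sum_congr rfl fun s _ => ?_
  have h2 : s = r ↔ (s : ℕ) = r := PNat.coe_inj.symm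
  simp only [h2]
  split_ifs <;> omega

/-- The degree `∑ r d_r` of a monomial in the power sums. -/
def monomialDegree (d : ℕ+ →₀ ℕ) : ℕ := ∑ r ∈ d.support, d r * (r : ℕ)

theorem weight_eq_monomialDegree (d : ℕ+ →₀ ℕ) :
    Finsupp.weight degreeWeight d = (monomialDegree d : ℤ) := by
  rw [Finsupp.weight_apply, Finsupp.sum, monomialDegree]
  push_cast
  exact Finset.sum_congr rfl fun r _ => by simp [degreeWeight]

theorem le_monomialDegree {d : ℕ+ →₀ ℕ} {r : ℕ+} (hr : r ∈ d.support) :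
    (r : ℕ) ≤ monomialDegree d := by
  refine le_trans ?_ (Finset.single_le_sum (f := fun r : ℕ+ => d r * (r : ℕ)) (by simp) hr)
  exact Nat.le_mul_of_pos_left _ (Nat.pos_of_ne_zero (Finsupp.mem_support_iff.1 hr))

/-- The Young diagram attached to a monomial in the power sums. -/
def monomialDiagram (d : ℕ+ →₀ ℕ) : YoungDiagram :=
  YoungDiagram.ofRows (conjugateRows d) (monomialDegree d) (antitone_conjugateRows d)

theorem conjugateRows_monomialDegree (d : ℕ+ →₀ ℕ) :
    conjugateRows d (monomialDegree d) = 0 := by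
  refine Finset.sum_eq_zero fun r hr => if_neg ?_
  have := le_monomialDegree hr
  omega

theorem rowLen_monomialDiagram (d : ℕ+ →₀ ℕ) (i : ℕ) :
    (monomialDiagram d).rowLen i = conjugateRows d i :=
  YoungDiagram.rowLen_ofRows _ (conjugateRows_monomialDegree d) i

theorem card_monomialDiagram (d : ℕ+ →₀ ℕ) : (monomialDiagram d).card = monomialDegree d := by
  rw [YoungDiagram.card_eq_sum_rowLen (n := monomialDegree d)]
  · simp only [rowLen_monomialDiagram, conjugateRows]
    rw [Finset.sum_comm]
    conv_rhs => rw [monomialDegree]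
    refine Finset.sum_congr rfl fun r hr => ?_
    rw [← Finset.sum_filter, Finset.sum_const, smul_eq_mul, mul_comm]
    congr 1
    have := le_monomialDegree hr
    have h2 : {j ∈ Finset.range (monomialDegree d) | j < (r : ℕ)} = Finset.range r := by
      ext j; simp only [Finset.mem_filter, Finset.mem_range]; omega
    rw [h2, Finset.card_range]
  · rw [← YoungDiagram.rowLen_eq_zero_iff, rowLen_monomialDiagram, conjugateRows_monomialDegree]

theorem injective_monomialDiagram : Function.Injective monomialDiagram := by
  intro d e h
  ext r
  have h1 := conjugateRows_sub d r
  have h2 := conjugateRows_sub e r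
  rw [← rowLen_monomialDiagram, ← rowLen_monomialDiagram, h] at h1
  rw [← rowLen_monomialDiagram, ← rowLen_monomialDiagram] at h2
  omega

theorem span_schur_eq (n : ℕ) :
    Submodule.span ℚ ((YoungDiagram.partitionsOf n).image (schur ℚ) : Set (SymFun ℚ)) =
      weightedHomogeneousSubmodule ℚ degreeWeight (n : ℤ) := by
  classical
  have hle : Submodule.span ℚ ((YoungDiagram.partitionsOf n).image (schur ℚ) : Set (SymFun ℚ)) ≤
      weightedHomogeneousSubmodule ℚ degreeWeight (n : ℤ) := by
    rw [Submodule.span_le]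
    rintro f hf
    simp only [Finset.coe_image, Set.mem_image, Finset.mem_coe, YoungDiagram.mem_partitionsOf] at hf
    obtain ⟨μ, rfl, rfl⟩ := hf
    exact homogeneous_schur μ
  let D : Finset (ℕ+ →₀ ℕ) := (YoungDiagram.partitionsOf n).preimage monomialDiagram
    injective_monomialDiagram.injOn
  let V : Submodule ℚ (SymFun ℚ) :=
    Submodule.span ℚ (D.image (fun d => monomial d (1 : ℚ)) : Set (SymFun ℚ))
  have hV : weightedHomogeneousSubmodule ℚ degreeWeight (n : ℤ) ≤ V := by
    intro f hf
    rw [f.as_sum]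
    refine Submodule.sum_mem _ fun d hd => ?_
    have h1 := hf (mem_support_iff.1 hd)
    rw [weight_eq_monomialDegree] at h1
    have h2 : monomial d (coeff d f) = coeff d f • monomial d (1 : ℚ) := by
      rw [smul_monomial, smul_eq_mul, mul_one]
    rw [h2]
    refine Submodule.smul_mem _ _ (Submodule.subset_span ?_)
    simp only [Finset.coe_image, Set.mem_image, Finset.mem_coe]
    refine ⟨d, ?_, rfl⟩
    rw [Finset.mem_preimage, YoungDiagram.mem_partitionsOf, card_monomialDiagram]
    exact_mod_cast h1
  have hfin : Module.finrank ℚ V ≤ (YoungDiagram.partitionsOf n).card := by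
    refine (finrank_span_finset_le_card _).trans (Finset.card_image_le.trans ?_)
    exact Finset.card_le_card_of_injOn monomialDiagram (fun d hd => Finset.mem_preimage.1 hd)
      injective_monomialDiagram.injOn
  have hcard : Module.finrank ℚ (Submodule.span ℚ
      ((YoungDiagram.partitionsOf n).image (schur ℚ) : Set (SymFun ℚ))) =
      (YoungDiagram.partitionsOf n).card := by
    rw [finrank_span_finset_eq_card, Finset.card_image_of_injective _ linearIndependent_schur.injective]
    exact (linearIndependent_schur.linearIndepOn_id).mono (by simp)
  have : FiniteDimensional ℚ V := FiniteDimensional.span_finset ℚ _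
  have heq := Submodule.eq_of_le_of_finrank_le (hle.trans hV) (by rw [hcard]; exact hfin)
  exact le_antisymm hle (heq ▸ hV)

theorem evalX_injOn {n N : ℕ} (hn : n ≤ N) {f : SymFun ℚ}
    (hf : IsWeightedHomogeneous degreeWeight f (n : ℤ)) (h : evalX N f = 0) : f = 0 := by
  classical
  have hf' : f ∈ Submodule.span ℚ (schur ℚ '' (YoungDiagram.partitionsOf n : Set YoungDiagram)) := by
    rw [← Finset.coe_image, span_schur_eq]
    exact hf
  rw [Finsupp.mem_span_image_iff_linearCombination] at hf'
  obtain ⟨l, hl, rfl⟩ := hf'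
  rw [eq_zero_of_evalX_linearCombination (N := N) (l := l) _ h, map_zero]
  intro μ hμ
  have := YoungDiagram.mem_partitionsOf.1 (hl hμ)
  have := μ.colLen_zero_le_card
  omega

theorem evalX_eq_of_homogeneous {n N : ℕ} (hn : n ≤ N) {f g : SymFun ℚ}
    (hf : IsWeightedHomogeneous degreeWeight f (n : ℤ))
    (hg : IsWeightedHomogeneous degreeWeight g (n : ℤ)) (h : evalX N f = evalX N g) : f = g := by
  rw [← sub_eq_zero]
  apply evalX_injOn hn
  · exact (weightedHomogeneousSubmodule ℚ degreeWeight (n : ℤ)).sub_mem hf hg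
  · rw [map_sub, h, sub_self]

theorem span_range_schur : Submodule.span ℚ (Set.range (schur ℚ)) = ⊤ := by
  classical
  rw [eq_top_iff]
  rintro f -
  rw [f.as_sum]
  refine Submodule.sum_mem _ fun d _ => ?_
  have h : monomial d (coeff d f) ∈
      weightedHomogeneousSubmodule ℚ degreeWeight (monomialDegree d : ℤ) := by
    apply isWeightedHomogeneous_monomial
    exact weight_eq_monomialDegree d
  rw [← span_schur_eq] at h
  refine Submodule.span_mono ?_ h
  simp

/-- The Schur basis of `Λ` over `ℚ`. -/
def schurBasisRat : Module.Basis YoungDiagram ℚ (SymFun ℚ) :=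
  Module.Basis.mk linearIndependent_schur (span_range_schur.ge)

/-- The Schur basis of `Λ`. -/
def schurBasis (K : Type*) [CommRing K] [Algebra ℚ K] : Module.Basis YoungDiagram K (SymFun K) :=
  (schurBasisRat.baseChange K).map (algebraTensorAlgEquiv ℚ K).toLinearEquiv

theorem schurBasis_apply (K : Type*) [CommRing K] [Algebra ℚ K] (μ : YoungDiagram) :
    schurBasis K μ = schur K μ := by
  rw [← map_schur, schurBasis, Module.Basis.map_apply, Module.Basis.baseChange_apply]
  simp [schurBasisRat]

theorem schurCoeffs_eq (K : Type*) [CommRing K] [Algebra ℚ K] (f : SymFun K) :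
    schurCoeffs f = (schurBasis K).repr f := by
  have h : ∀ l, Finsupp.linearCombination K (schur K) l = (schurBasis K).repr.symm l := by
    intro l
    rw [Module.Basis.repr_symm_apply]
    congr 2
    funext μ
    exact (schurBasis_apply K μ).symm
  have hinj : Function.Injective (Finsupp.linearCombination K (schur K)) := by
    intro a b hab
    rw [h, h] at hab
    exact (schurBasis K).repr.symm.injective hab
  apply hinj
  have hex : ∃ l, Finsupp.linearCombination K (schur K) l = f :=
    ⟨(schurBasis K).repr f, by rw [h]; simp⟩
  rw [schurCoeffs, Function.invFun_eq hex, h]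
  simp

theorem lrCoeff_eq (K : Type*) [CommRing K] [Algebra ℚ K] (μ ν ρ : YoungDiagram) :
    lrCoeff K μ ν ρ = (schurBasis K).repr (schur K ν * schur K ρ) μ := by
  rw [lrCoeff, hallInner, schurCoeffs_eq, schurCoeffs_eq, ← schurBasis_apply K μ,
    Module.Basis.repr_self, Finsupp.sum_single_index] <;> simp

theorem sum_lrCoeff_smul_schur (K : Type*) [CommRing K] [Algebra ℚ K] (ν ρ : YoungDiagram) {n : ℕ}
    (hn : ν.card + ρ.card = n) :
    ∑ μ ∈ YoungDiagram.partitionsOf n, lrCoeff K μ ν ρ • schur K μ = schur K ν * schur K ρ := by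
  classical
  have h1 : schur ℚ ν * schur ℚ ρ ∈ weightedHomogeneousSubmodule ℚ degreeWeight (n : ℤ) := by
    have := (homogeneous_schur ν).mul (homogeneous_schur ρ)
    rw [mem_weightedHomogeneousSubmodule, ← hn]
    push_cast
    exact this
  rw [← span_schur_eq, Finset.coe_image, Finsupp.mem_span_image_iff_linearCombination] at h1
  obtain ⟨l, hl, h1⟩ := h1
  have h2 : schur K ν * schur K ρ =
      ∑ μ ∈ YoungDiagram.partitionsOf n, algebraMap ℚ K (l μ) • schur K μ := by
    rw [← map_schur K, ← map_schur K, ← map_mul, ← h1, Finsupp.linearCombination_apply,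
      Finsupp.sum_of_support_subset _ hl _ (by simp), map_sum]
    refine Finset.sum_congr rfl fun μ _ => ?_
    rw [← map_schur K, smul_eq_C_mul, map_mul, map_C, smul_eq_C_mul]
  rw [h2]
  refine Finset.sum_congr rfl fun μ hμ => ?_
  rw [lrCoeff_eq, h2]
  congr 1
  simp only [← schurBasis_apply, map_sum, map_smul, Module.Basis.repr_self]
  rw [Finsupp.finsetSum_apply, Finset.sum_eq_single μ]
  · simp [Algebra.smul_def]
  · intro b _ hb; simp [hb]
  · exact fun h => absurd hμ h

end SymFun

theorem Matrix.det_sum_smul_rows {R : Type*} [CommRing R] {n : ℕ} {κ : Type*}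
    (S : Fin n → Finset κ) (g : Fin n → κ → R) (v : Fin n → κ → Fin n → R) :
    Matrix.det (Matrix.of fun i j => ∑ c ∈ S i, g i c * v i c j) =
      ∑ p ∈ Fintype.piFinset S, (∏ i, g i (p i)) * Matrix.det (Matrix.of fun i => v i (p i)) := by
  classical
  have h := (Matrix.detRowAlternating (R := R) (n := Fin n)).toMultilinearMap.map_sum_finset
    (fun i c => g i c • v i c) S
  have h1 : (fun i => ∑ c ∈ S i, g i c • v i c) =
      (Matrix.of fun i j => ∑ c ∈ S i, g i c * v i c j) := by
    ext i j
    simp [Finset.sum_apply]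
  rw [h1] at h
  refine h.trans (Finset.sum_congr rfl fun p _ => ?_)
  rw [MultilinearMap.map_smul_univ, smul_eq_mul]
  rfl

theorem Matrix.det_eq_of_forall_row_eq_smul_add_succ {R : Type*} [CommRing R] {n : ℕ}
    {A B : Matrix (Fin (n + 1)) (Fin (n + 1)) R} (c : Fin n → R)
    (hlast : ∀ j, A (Fin.last n) j = B (Fin.last n) j)
    (h : ∀ (i : Fin n) (j), A i.castSucc j = B i.castSucc j + c i * A i.succ j) :
    A.det = B.det := by
  rw [← Matrix.det_submatrix_equiv_self Fin.revPerm A, ← Matrix.det_submatrix_equiv_self Fin.revPerm B]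
  apply Matrix.det_eq_of_forall_row_eq_smul_add_pred (fun i => c i.rev)
  · intro j
    simp [hlast]
  · intro i j
    simp only [Matrix.submatrix_apply, Fin.revPerm_apply, Fin.rev_succ, Fin.rev_castSucc]
    exact h _ _

namespace YoungDiagram

/-- `μ` is obtained from `lam` by removing a horizontal strip. -/
def Interlaces (μ lam : YoungDiagram) : Prop :=
  ∀ i, lam.rowLen (i + 1) ≤ μ.rowLen i ∧ μ.rowLen i ≤ lam.rowLen i

theorem exists_rowLen_eq {n : ℕ} (g : Fin n → ℕ) (hg : Antitone g) :
    ∃ μ : YoungDiagram, (∀ i : Fin n, μ.rowLen i = g i) ∧ ∀ i, n ≤ i → μ.rowLen i = 0 := by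
  have hf : Antitone fun i : ℕ => if h : i < n then g ⟨i, h⟩ else 0 := by
    intro i j hij
    by_cases hj : j < n
    · have hi : i < n := by omega
      simp only [hi, hj, dif_pos]
      exact hg hij
    · simp [hj]
  refine ⟨ofRows _ n hf, fun i => ?_, fun i hi => ?_⟩
  · rw [rowLen_ofRows hf (by simp)]; simp
  · rw [rowLen_ofRows hf (by simp)]; simp [hi.not_gt]

/-- The diagrams with at most `n` cells. -/
def upTo (n : ℕ) : Finset YoungDiagram :=
  open Classical in (Finset.range (n + 1)).biUnion partitionsOf

theorem mem_upTo {n : ℕ} {μ : YoungDiagram} : μ ∈ upTo n ↔ μ.card ≤ n := by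
  simp [upTo, mem_partitionsOf]

theorem card_le_card_of_rowLen_le {μ ν : YoungDiagram} (h : ∀ i, μ.rowLen i ≤ ν.rowLen i) :
    μ.card ≤ ν.card := by
  apply Finset.card_le_card
  rintro ⟨i, j⟩ hij
  rw [mem_cells, mem_iff_lt_rowLen] at hij ⊢
  exact hij.trans_le (h i)

theorem card_eq_sum_fin (μ : YoungDiagram) {n : ℕ} (hn : μ.colLen 0 ≤ n) :
    μ.card = ∑ i : Fin n, μ.rowLen i := by
  rw [card_eq_sum_rowLen μ hn, Finset.sum_range]

theorem card_eq_add_sum_fin {μ ν : YoungDiagram} (h : ∀ i, μ.rowLen i ≤ ν.rowLen i) {n : ℕ}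
    (hn : ν.colLen 0 ≤ n) : ν.card = μ.card + ∑ i : Fin n, (ν.rowLen i - μ.rowLen i) := by
  have hμ : μ.colLen 0 ≤ n := by
    rw [← rowLen_eq_zero_iff]
    have := h n
    have := rowLen_eq_zero_iff.2 hn
    omega
  rw [card_eq_sum_fin ν hn, card_eq_sum_fin μ hμ, ← Finset.sum_add_distrib]
  exact Finset.sum_congr rfl fun i _ => by have := h i; omega

end YoungDiagram

namespace SymFun
open YoungDiagram

section Branching
variable {R : Type*} [CommRing R] [Algebra ℚ R]

theorem evalVars_cons_complete {N : ℕ} (x : Fin N → R) (t : R) (m : ℤ) :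
    evalVars (Fin.cons t x : Fin (N + 1) → R) (completeInt ℚ m) = evalVars x (completeInt ℚ m) +
      t * evalVars (Fin.cons t x : Fin (N + 1) → R) (completeInt ℚ (m - 1)) := by
  rcases lt_or_ge m 0 with h | h
  · rw [completeInt_of_neg h, completeInt_of_neg (by omega)]; simp
  lift m to ℕ using h
  have key : (∏ i, completeSeries fun r : ℕ+ => (Fin.cons t x : Fin (N + 1) → R) i ^ (r : ℕ)) *
      (1 - PowerSeries.C t * PowerSeries.X) =
        ∏ i, completeSeries fun r : ℕ+ => x i ^ (r : ℕ) := by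
    rw [Fin.prod_univ_succ, mul_right_comm]
    simp only [Fin.cons_zero, Fin.cons_succ]
    rw [completeSeries_pow_mul, one_mul]
  have h := congrArg (PowerSeries.coeff m) key
  rw [completeInt_natCast, evalVars_complete, evalVars_complete, ← h]
  rcases m with _ | m
  · rw [completeInt_of_neg (by simp), mul_sub]
    simp
  · have : ((m + 1 : ℕ) : ℤ) - 1 = (m : ℕ) := by push_cast; ring
    rw [this, completeInt_natCast, evalVars_complete, mul_sub, mul_one, map_sub, ← mul_assoc,
      PowerSeries.coeff_succ_mul_X, mul_comm _ (PowerSeries.C t), PowerSeries.coeff_C_mul]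
    ring

theorem evalVars_cons_complete_sum {N : ℕ} (x : Fin N → R) (t : R) (m : ℤ) (k : ℕ) :
    evalVars (Fin.cons t x : Fin (N + 1) → R) (completeInt ℚ m) =
      ∑ c ∈ Finset.range k, t ^ c * evalVars x (completeInt ℚ (m - c)) +
        t ^ k * evalVars (Fin.cons t x : Fin (N + 1) → R) (completeInt ℚ (m - k)) := by
  induction k with
  | zero => simp
  | succ k ih =>
    rw [ih, evalVars_cons_complete x t (m - k), Finset.sum_range_succ]
    have : m - (k : ℤ) - 1 = m - (k + 1 : ℕ) := by push_cast; ring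
    rw [this]
    ring

theorem evalVars_cons_jacobiTrudi {N : ℕ} (x : Fin N → R) (t : R) (f : ℕ → ℕ) (hf : Antitone f)
    (n : ℕ) (hn : f n = 0) :
    evalVars (Fin.cons t x : Fin (N + 1) → R) (jacobiTrudi f n) =
      ∑ p ∈ Fintype.piFinset fun i : Fin n => Finset.range (f i - f (i + 1) + 1),
        t ^ (∑ i, p i) * evalVars x (Matrix.det (Matrix.of fun i j : Fin n =>
          completeInt ℚ ((f i : ℤ) - (i : ℕ) + (j : ℕ) - (p i : ℕ)))) := by
  rcases n with _ | n
  · simp [jacobiTrudi]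
  rw [jacobiTrudi, AlgHom.map_det]
  rw [Matrix.det_eq_of_forall_row_eq_smul_add_succ (fun i => t ^ (f i - f (i + 1) + 1))
    (B := Matrix.of fun i j : Fin (n + 1) => ∑ c ∈ Finset.range (f i - f (i + 1) + 1),
      t ^ c * evalVars x (completeInt ℚ ((f i : ℤ) - (i : ℕ) + (j : ℕ) - (c : ℕ))))]
  · rw [Matrix.det_sum_smul_rows (fun i : Fin (n + 1) => Finset.range (f i - f (i + 1) + 1))
      (fun _ c => t ^ c)
      (fun i c j => evalVars x (completeInt ℚ ((f i : ℤ) - (i : ℕ) + (j : ℕ) - (c : ℕ))))]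
    refine Finset.sum_congr rfl fun p _ => ?_
    rw [Finset.prod_pow_eq_pow_sum, AlgHom.map_det]
    rfl
  · intro j
    simp only [AlgHom.mapMatrix_apply, Matrix.map_apply, Matrix.of_apply]
    rw [evalVars_cons_complete_sum x t _ (f (Fin.last n) - f ((Fin.last n : ℕ) + 1) + 1)]
    rw [completeInt_of_neg (n := _ - ((f (Fin.last n) - f ((Fin.last n : ℕ) + 1) + 1 : ℕ) : ℤ)),
      map_zero, mul_zero, add_zero]
    have := j.2
    simp only [Fin.val_last, hn]
    push_cast
    omega
  · intro i j
    simp only [AlgHom.mapMatrix_apply, Matrix.map_apply, Matrix.of_apply, Fin.val_castSucc,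
      Fin.val_succ]
    rw [evalVars_cons_complete_sum x t _ (f i - f (i + 1) + 1)]
    congr 4
    have := hf (Nat.le_succ i)
    push_cast [this]
    simp only [Nat.succ_eq_add_one] at this
    omega

open Classical in
theorem evalVars_cons_schur {N : ℕ} (x : Fin N → R) (t : R) (lam : YoungDiagram) {m : ℕ}
    (hm : lam.card ≤ m) :
    evalVars (Fin.cons t x : Fin (N + 1) → R) (schur ℚ lam) =
      ∑ μ ∈ upTo m with Interlaces μ lam, t ^ (lam.card - μ.card) * evalVars x (schur ℚ μ) := by
  set n := lam.colLen 0 with hn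
  have hlam0 : lam.rowLen n = 0 := rowLen_eq_zero_iff.2 le_rfl
  rw [schur_eq_jacobiTrudi lam le_rfl, evalVars_cons_jacobiTrudi x t _ lam.rowLen_anti _ hlam0]
  symm
  have hlen : ∀ μ, Interlaces μ lam → μ.colLen 0 ≤ n := by
    intro μ hμ
    rw [← rowLen_eq_zero_iff]
    have := (hμ n).2
    omega
  refine Finset.sum_bij (fun μ _ (i : Fin n) => lam.rowLen i - μ.rowLen i) ?_ ?_ ?_ ?_
  · intro μ hμ
    rw [Finset.mem_filter] at hμ
    rw [Fintype.mem_piFinset]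
    intro i
    have := hμ.2 i
    rw [Finset.mem_range]
    omega
  · intro μ hμ ν hν h
    rw [Finset.mem_filter] at hμ hν
    apply ext_rowLen
    intro i
    by_cases hi : i < n
    · have h1 := congrFun h ⟨i, hi⟩
      have := hμ.2 i
      have := hν.2 i
      simp only at h1
      omega
    · rw [rowLen_eq_zero_iff.2 ((hlen μ hμ.2).trans (not_lt.1 hi)),
        rowLen_eq_zero_iff.2 ((hlen ν hν.2).trans (not_lt.1 hi))]
  · intro p hp
    rw [Fintype.mem_piFinset] at hp
    obtain ⟨μ, h1, h2⟩ := exists_rowLen_eq (fun i => lam.rowLen i - p i) (by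
      intro i j hij
      rcases hij.eq_or_lt with rfl | hij
      · rfl
      have := hp i
      have h3 := lam.rowLen_anti (i + 1) j hij
      simp only [Finset.mem_range] at this
      have h4 := lam.rowLen_anti i (i + 1) (by omega)
      show lam.rowLen j - p j ≤ lam.rowLen i - p i
      omega)
    have hint : Interlaces μ lam := by
      intro i
      by_cases hi : i < n
      · have h3 := hp ⟨i, hi⟩
        have h4 := h1 ⟨i, hi⟩
        have h5 := lam.rowLen_anti i (i + 1) (by omega)
        simp only [Finset.mem_range] at h3 h4
        omega
      · rw [h2 i (not_lt.1 hi)]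
        have := lam.rowLen_anti n (i + 1) (by omega)
        omega
    refine ⟨μ, ?_, ?_⟩
    · rw [Finset.mem_filter, mem_upTo]
      exact ⟨(card_le_card_of_rowLen_le fun i => (hint i).2).trans hm, hint⟩
    · funext i
      have h3 := hp i
      have h5 := lam.rowLen_anti i (i + 1) (by omega)
      simp only [Finset.mem_range] at h3
      have := h1 i
      omega
  · intro μ hμ
    rw [Finset.mem_filter] at hμ
    have h1 : lam.card - μ.card = ∑ i : Fin n, (lam.rowLen i - μ.rowLen i) := by
      rw [card_eq_add_sum_fin (fun i => (hμ.2 i).2) hn.symm.le, add_tsub_cancel_left]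
    rw [h1, schur_eq_jacobiTrudi μ (hlen μ hμ.2), jacobiTrudi]
    congr 4
    ext i j : 2
    simp only
    congr 1
    have := (hμ.2 i).2
    push_cast [this]
    ring

end Branching

end SymFun

namespace SymFun
open YoungDiagram

section Pieri
variable {R : Type*} [CommRing R] [Algebra ℚ R]

theorem geometric_eq {R : Type*} [CommRing R] (t : R) (b k : ℕ) :
    PowerSeries.C (t ^ b) * PowerSeries.mk (fun n => t ^ n) =
      ∑ c ∈ Finset.range k, PowerSeries.X ^ c * PowerSeries.C (t ^ (b + c)) +
        PowerSeries.X ^ k * (PowerSeries.C (t ^ (b + k)) * PowerSeries.mk (fun n => t ^ n)) := by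
  induction k with
  | zero => simp
  | succ k ih =>
    have h : PowerSeries.mk (fun n => t ^ n) =
        1 + PowerSeries.X * (PowerSeries.C t * PowerSeries.mk (fun n => t ^ n)) := by
      ext n
      rcases n with _ | n
      · simp
      · rw [map_add, PowerSeries.coeff_succ_X_mul, PowerSeries.coeff_C_mul]
        simp [PowerSeries.coeff_one, pow_succ']
    rw [ih, Finset.sum_range_succ, add_assoc]
    congr 1
    conv_lhs => rw [h]
    rw [← add_assoc b k 1, pow_succ t (b + k), map_mul, mul_add, mul_add, mul_one, pow_succ]
    congr 1
    simp only [mul_assoc, mul_left_comm]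

theorem complete_mul_alternant {n : ℕ} (x : Fin (n + 1) → R) (f : ℕ → ℕ) (hf : Antitone f)
    (m : ℕ) :
    evalVars x (complete ℚ m) * alternant x (shifted (n + 1) f) =
      ∑ p ∈ (Fintype.piFinset fun i : Fin (n + 1) => Finset.range
          ((if (i : ℕ) = 0 then m else f (i - 1) - f i) + 1)) with ∑ i, p i = m,
        alternant x (fun i => shifted (n + 1) f i + p i) := by
  set β := shifted (n + 1) f with hβ
  set k : Fin (n + 1) → ℕ := fun i => (if (i : ℕ) = 0 then m else f (i - 1) - f i) + 1 with hk
  let W : ℕ → Fin (n + 1) → PowerSeries R := fun b j =>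
    PowerSeries.C (x j ^ b) * PowerSeries.mk (fun n => x j ^ n)
  let U : Matrix (Fin (n + 1)) (Fin (n + 1)) (PowerSeries R) := Matrix.of fun i j =>
    ∑ c ∈ Finset.range (k i), PowerSeries.X ^ c * PowerSeries.C (x j ^ (β i + c))
  have hW : ∀ i j, W (β i) j = U i j + PowerSeries.X ^ (k i) * W (β i + k i) j := by
    intro i j
    simp only [W, U, Matrix.of_apply]
    exact geometric_eq _ _ _
  have h1 : PowerSeries.C (alternant x β) *
      ∏ i, completeSeries (fun r : ℕ+ => x i ^ (r : ℕ)) =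
        Matrix.det (Matrix.of fun i j => W (β i) j) := by
    have : (Matrix.of fun i j => W (β i) j) = Matrix.of fun i j =>
        PowerSeries.mk (fun n => x j ^ n) * (PowerSeries.C (R := R)).mapMatrix
          (Matrix.of fun i j => x j ^ β i) i j := by
      ext i j : 2
      simp only [Matrix.of_apply, RingHom.mapMatrix_apply, Matrix.map_apply, W]
      rw [mul_comm]
    rw [this, Matrix.det_mul_row, alternant, RingHom.map_det, mul_comm]
    simp only [completeSeries_pow]
  have h2 : Matrix.det (Matrix.of fun i j => W (β i) j) =
      Matrix.det (U.updateRow 0 (W (β 0))) := by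
    apply Matrix.det_eq_of_forall_row_eq_smul_add_pred
      (fun i => PowerSeries.X ^ (k i.succ))
    · intro j
      simp
    · intro i j
      rw [Matrix.updateRow_ne (Fin.succ_ne_zero i), Matrix.of_apply, Matrix.of_apply, hW]
      congr 3
      have h3 := hf (Nat.le_succ i)
      have := i.2
      simp only [Nat.succ_eq_add_one] at h3
      simp only [hβ, hk, shifted, Fin.val_succ, Fin.val_castSucc, Nat.add_sub_cancel,
        Nat.succ_ne_zero, if_false]
      omega
  have h3 : Matrix.det (U.updateRow 0 (W (β 0))) = U.det +
      PowerSeries.X ^ (m + 1) * Matrix.det (U.updateRow 0 (W (β 0 + k 0))) := by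
    have : W (β 0) = U 0 + (PowerSeries.X : PowerSeries R) ^ (m + 1) • W (β 0 + k 0) := by
      funext j
      rw [hW]
      simp [hk]
    rw [this, Matrix.det_updateRow_add, Matrix.det_updateRow_smul, Matrix.updateRow_eq_self]
  have h4 : U.det = ∑ p ∈ Fintype.piFinset fun i => Finset.range (k i),
      PowerSeries.X ^ (∑ i, p i) * PowerSeries.C (alternant x fun i => β i + p i) := by
    rw [Matrix.det_sum_smul_rows (fun i => Finset.range (k i)) (fun _ c => PowerSeries.X ^ c)
      (fun i c j => PowerSeries.C (x j ^ (β i + c)))]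
    refine Finset.sum_congr rfl fun p _ => ?_
    rw [Finset.prod_pow_eq_pow_sum, alternant, RingHom.map_det]
    rfl
  have h5 := congrArg (PowerSeries.coeff m) (h1.trans (h2.trans h3))
  rw [PowerSeries.coeff_C_mul, map_add, PowerSeries.coeff_X_pow_mul', if_neg (by omega), add_zero,
    h4, map_sum] at h5
  rw [evalVars_complete, mul_comm, h5, Finset.sum_filter]
  refine Finset.sum_congr rfl fun p _ => ?_
  rw [PowerSeries.coeff_X_pow_mul', PowerSeries.coeff_C]
  by_cases h : ∑ i, p i = m
  · simp [h]
  · rw [if_neg h]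
    split_ifs
    · omega
    · rfl
    · rfl

open Classical in
theorem complete_mul_schur (ν : YoungDiagram) (m : ℕ) :
    complete ℚ m * schur ℚ ν =
      ∑ lam ∈ partitionsOf (ν.card + m) with Interlaces ν lam, schur ℚ lam := by
  set n := ν.card + m with hn
  apply evalX_eq_of_homogeneous (n := n) (N := n + 1) (by omega)
  · have := (homogeneous_complete m).mul (homogeneous_schur ν)
    have h : ((n : ℕ) : ℤ) = (m : ℤ) + (ν.card : ℤ) := by rw [hn]; push_cast; ring
    rw [h]
    exact this
  · refine (MvPolynomial.weightedHomogeneousSubmodule ℚ degreeWeight (n : ℤ)).sum_mem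
      fun lam hlam => ?_
    rw [Finset.mem_filter, mem_partitionsOf] at hlam
    rw [← hlam.1]
    exact homogeneous_schur lam
  · apply mul_right_cancel₀ (alternant_X_ne_zero (n + 1))
    have hνn : ν.colLen 0 ≤ n + 1 := by have := ν.colLen_zero_le_card; omega
    have hlen : ∀ lam ∈ partitionsOf n, lam.colLen 0 ≤ n + 1 := by
      intro lam h
      rw [mem_partitionsOf] at h
      have := lam.colLen_zero_le_card
      omega
    rw [map_mul, mul_assoc, evalX_schur_mul hνn, evalX,
      complete_mul_alternant _ _ ν.rowLen_anti, map_sum, Finset.sum_mul]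
    symm
    refine Finset.sum_bij (fun lam _ (i : Fin (n + 1)) => lam.rowLen i - ν.rowLen i) ?_ ?_ ?_ ?_
    · intro lam hlam
      rw [Finset.mem_filter] at hlam
      have hsum := card_eq_add_sum_fin (fun i => (hlam.2 i).2) (hlen lam hlam.1)
      have hc := mem_partitionsOf.1 hlam.1
      rw [Finset.mem_filter, Fintype.mem_piFinset]
      refine ⟨fun i => ?_, show ∑ i : Fin (n + 1), (lam.rowLen i - ν.rowLen i) = m by omega⟩
      rw [Finset.mem_range]
      split_ifs with h0
      · have := Finset.single_le_sum (f := fun i : Fin (n + 1) => lam.rowLen i - ν.rowLen i)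
          (by simp) (Finset.mem_univ i)
        omega
      · have := hlam.2 i
        have h6 := (hlam.2 (i - 1)).1
        rw [Nat.sub_add_cancel (by omega)] at h6
        omega
    · intro lam hlam lam' hlam' h
      rw [Finset.mem_filter] at hlam hlam'
      apply ext_rowLen
      intro i
      by_cases hi : i < n + 1
      · have h1 := congrFun h ⟨i, hi⟩
        have := hlam.2 i
        have := hlam'.2 i
        simp only at h1
        omega
      · rw [rowLen_eq_zero_iff.2 ((hlen lam hlam.1).trans (not_lt.1 hi)),
          rowLen_eq_zero_iff.2 ((hlen lam' hlam'.1).trans (not_lt.1 hi))]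
    · intro p hp
      rw [Finset.mem_filter, Fintype.mem_piFinset] at hp
      obtain ⟨hp, hpm⟩ := hp
      have hp' : ∀ i j : Fin (n + 1), (i : ℕ) < j → p j + ν.rowLen j ≤ ν.rowLen i := by
        intro i j hij
        have h1 := hp j
        rw [Finset.mem_range, if_neg (by omega)] at h1
        have h2 := ν.rowLen_anti i (j - 1) (by omega)
        have h3 := ν.rowLen_anti (j - 1) j (by omega)
        omega
      obtain ⟨lam, h1, h2⟩ := exists_rowLen_eq (fun i : Fin (n + 1) => ν.rowLen i + p i) (by
        intro i j hij
        rcases hij.eq_or_lt with rfl | hij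
        · rfl
        have := hp' i j hij
        show ν.rowLen j + p j ≤ ν.rowLen i + p i
        omega)
      have hint : Interlaces ν lam := by
        intro i
        by_cases hi : i < n + 1
        · have h4 := h1 ⟨i, hi⟩
          simp only at h4
          refine ⟨?_, by omega⟩
          by_cases hi' : i + 1 < n + 1
          · have h5 := h1 ⟨i + 1, hi'⟩
            have h6 := hp' ⟨i, hi⟩ ⟨i + 1, hi'⟩ (by simp)
            simp only at h5 h6
            omega
          · rw [h2 _ (not_lt.1 hi')]
            omega
        · rw [h2 i (not_lt.1 hi), h2 (i + 1) (by omega), rowLen_eq_zero_iff.2 (by omega)]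
          omega
      have hlam0 : lam.colLen 0 ≤ n + 1 := by
        rw [← rowLen_eq_zero_iff]
        exact h2 _ le_rfl
      have hpe : (fun i : Fin (n + 1) => lam.rowLen i - ν.rowLen i) = p := by
        funext i
        have := h1 i
        omega
      refine ⟨lam, ?_, hpe⟩
      rw [Finset.mem_filter, mem_partitionsOf]
      refine ⟨?_, hint⟩
      rw [card_eq_add_sum_fin (fun i => (hint i).2) hlam0, hpe, hpm]
    · intro lam hlam
      rw [Finset.mem_filter] at hlam
      have := evalX_schur_mul (hlen lam hlam.1)
      rw [evalX] at this
      rw [this]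
      congr 1
      funext i
      have := (hlam.2 i).2
      simp only [shifted]
      omega

end Pieri
end SymFun

namespace YoungDiagram

theorem isEven_iff {ν : YoungDiagram} :
    IsEven ν ↔ ∀ i, ν.rowLen (2 * i) = ν.rowLen (2 * i + 1) := by
  constructor
  · intro h i
    by_contra hne
    have h1 := ν.rowLen_anti (2 * i) (2 * i + 1) (by omega)
    have h2 := (lt_colLen_iff (μ := ν) (i := 2 * i) (j := ν.rowLen (2 * i + 1))).2 (by omega)
    have h3 := (lt_colLen_iff (μ := ν) (i := 2 * i + 1) (j := ν.rowLen (2 * i + 1))).not.2 (by omega)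
    obtain ⟨c, hc⟩ := h (ν.rowLen (2 * i + 1))
    omega
  · intro h j
    by_contra hodd
    rw [Nat.not_even_iff_odd] at hodd
    obtain ⟨i, hi⟩ := hodd
    have h2 := (lt_colLen_iff (μ := ν) (i := 2 * i) (j := j)).1 (by omega)
    have h3 := (lt_colLen_iff (μ := ν) (i := 2 * i + 1) (j := j)).not.1 (by omega)
    have := h i
    omega

theorem antitone_pairRows (μ : YoungDiagram) (e : ℕ) :
    Antitone fun i => μ.rowLen (2 * (i / 2) + e) := by
  intro i j hij
  exact μ.rowLen_anti _ _ (by have := Nat.div_le_div_right (c := 2) hij; omega)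

/-- The diagram in which rows `2 i` and `2 i + 1` have the length of row `2 i + e` of `μ`. -/
def pairRows (μ : YoungDiagram) (e : ℕ) : YoungDiagram :=
  ofRows (fun i => μ.rowLen (2 * (i / 2) + e)) (2 * μ.colLen 0) (antitone_pairRows μ e)

theorem rowLen_pairRows (μ : YoungDiagram) (e i : ℕ) :
    (pairRows μ e).rowLen i = μ.rowLen (2 * (i / 2) + e) :=
  rowLen_ofRows (antitone_pairRows μ e) (rowLen_eq_zero_iff.2 (by omega)) i

theorem isEven_pairRows (μ : YoungDiagram) (e : ℕ) : IsEven (pairRows μ e) := by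
  rw [isEven_iff]
  intro i
  rw [rowLen_pairRows, rowLen_pairRows]
  congr 1
  omega

theorem card_pairRows_add (μ : YoungDiagram) :
    (pairRows μ 0).card + (pairRows μ 1).card = 2 * μ.card := by
  have hlen : ∀ e, (pairRows μ e).colLen 0 ≤ 2 * μ.colLen 0 := by
    intro e
    rw [← rowLen_eq_zero_iff, rowLen_pairRows, rowLen_eq_zero_iff]
    omega
  rw [card_eq_sum_rowLen _ (hlen 0), card_eq_sum_rowLen _ (hlen 1),
    card_eq_sum_rowLen μ (n := 2 * μ.colLen 0) (by omega)]
  generalize μ.colLen 0 = M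
  induction M with
  | zero => simp
  | succ M ih =>
    rw [Nat.mul_succ, Finset.sum_range_succ, Finset.sum_range_succ, Finset.sum_range_succ,
      Finset.sum_range_succ, Finset.sum_range_succ, Finset.sum_range_succ]
    have h1 : 2 * (2 * M / 2) = 2 * M := by omega
    have h2 : 2 * ((2 * M + 1) / 2) = 2 * M := by omega
    simp only [rowLen_pairRows, h1, h2] at ih ⊢
    simp only [add_zero] at ih ⊢
    omega

theorem interlaces_even_iff {μ ν : YoungDiagram} (hν : IsEven ν) :
    Interlaces μ ν ↔ ν = pairRows μ 0 := by
  rw [isEven_iff] at hν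
  constructor
  · intro h
    apply ext_rowLen
    intro i
    rw [rowLen_pairRows, add_zero]
    have h1 := h (2 * (i / 2))
    have h2 := hν (i / 2)
    rcases Nat.mod_two_eq_zero_or_one i with hi | hi
    · have h3 : ν.rowLen i = ν.rowLen (2 * (i / 2)) := congrArg _ (by omega)
      omega
    · have h3 : ν.rowLen i = ν.rowLen (2 * (i / 2) + 1) := congrArg _ (by omega)
      omega
  · rintro rfl i
    rw [rowLen_pairRows, rowLen_pairRows]
    exact ⟨μ.rowLen_anti _ _ (by omega), μ.rowLen_anti _ _ (by omega)⟩

theorem even_interlaces_iff {μ ν : YoungDiagram} (hν : IsEven ν) :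
    Interlaces ν μ ↔ ν = pairRows μ 1 := by
  rw [isEven_iff] at hν
  constructor
  · intro h
    apply ext_rowLen
    intro i
    rw [rowLen_pairRows]
    have h1 := h (2 * (i / 2))
    have h1' := h (2 * (i / 2) + 1)
    have h2 := hν (i / 2)
    rcases Nat.mod_two_eq_zero_or_one i with hi | hi
    · have h3 : ν.rowLen i = ν.rowLen (2 * (i / 2)) := congrArg _ (by omega)
      omega
    · have h3 : ν.rowLen i = ν.rowLen (2 * (i / 2) + 1) := congrArg _ (by omega)
      omega
  · rintro rfl i
    rw [rowLen_pairRows]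
    exact ⟨μ.rowLen_anti _ _ (by omega), μ.rowLen_anti _ _ (by omega)⟩

theorem mem_evenPartitionsOf {n : ℕ} {ν : YoungDiagram} :
    ν ∈ evenPartitionsOf n ↔ ν.card = n ∧ IsEven ν := by
  classical
  simp [evenPartitionsOf, mem_partitionsOf]

end YoungDiagram

namespace SymFun
open YoungDiagram

/-- The plethysm `f ↦ f[e₂]`. -/
def plethysmTwo : SymFun ℚ →ₐ[ℚ] SymFun ℚ :=
  MvPolynomial.aeval fun r : ℕ+ => (2⁻¹ : ℚ) • (powerSum ℚ r ^ 2 - powerSum ℚ (2 * r))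

theorem homogeneous_aeval {c : ℤ} {g : ℕ+ → SymFun ℚ}
    (hg : ∀ r, MvPolynomial.IsWeightedHomogeneous degreeWeight (g r) (c * degreeWeight r))
    {f : SymFun ℚ} {n : ℤ} (hf : MvPolynomial.IsWeightedHomogeneous degreeWeight f n) :
    MvPolynomial.IsWeightedHomogeneous degreeWeight (MvPolynomial.aeval g f) (c * n) := by
  rw [f.as_sum, map_sum]
  refine Submodule.sum_mem (MvPolynomial.weightedHomogeneousSubmodule ℚ degreeWeight _)
    fun d hd => ?_
  have hd' := hf (MvPolynomial.mem_support_iff.1 hd)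
  rw [MvPolynomial.aeval_monomial, ← Algebra.smul_def]
  refine Submodule.smul_mem _ _ ?_
  have h := MvPolynomial.IsWeightedHomogeneous.prod (w := degreeWeight) d.support
    (fun r => g r ^ d r) (fun r => d r • (c * degreeWeight r)) (fun r _ => (hg r).pow _)
  have h2 : ∑ r ∈ d.support, d r • (c * degreeWeight r) = c * n := by
    rw [← hd', Finsupp.weight_apply, Finsupp.sum, Finset.mul_sum]
    refine Finset.sum_congr rfl fun r _ => ?_
    simp only [nsmul_eq_mul]
    ring
  rw [h2] at h
  exact h

theorem homogeneous_plethysmTwo {f : SymFun ℚ} {n : ℤ}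
    (hf : MvPolynomial.IsWeightedHomogeneous degreeWeight f n) :
    MvPolynomial.IsWeightedHomogeneous degreeWeight (plethysmTwo f) (2 * n) := by
  refine homogeneous_aeval (fun r => ?_) hf
  refine (MvPolynomial.weightedHomogeneousSubmodule ℚ degreeWeight _).smul_mem _
    (Submodule.sub_mem _ ?_ ?_)
  · have := (homogeneous_powerSum r).pow 2
    rw [nsmul_eq_mul] at this
    exact this
  · exact homogeneous_powerSum (2 * r)

theorem homogeneous_elementary (n : ℕ) :
    MvPolynomial.IsWeightedHomogeneous degreeWeight (elementary n) (n : ℤ) := by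
  rw [← one_mul (n : ℤ)]
  refine homogeneous_aeval (fun r => ?_) (homogeneous_complete n)
  rw [one_mul, ← smul_eq_mul, show ((-1) ^ ((r : ℕ) + 1) : SymFun ℚ) =
    algebraMap ℚ (SymFun ℚ) ((-1) ^ ((r : ℕ) + 1)) by simp, algebraMap_smul]
  exact (MvPolynomial.weightedHomogeneousSubmodule ℚ degreeWeight _).smul_mem _
    (homogeneous_powerSum r)

variable {R : Type*} [CommRing R] [Algebra ℚ R]

/-- The power sums of the products `x_i x_j`, `i < j`. -/
def pairPowerSum {N : ℕ} (x : Fin N → R) (r : ℕ+) : R :=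
  (2⁻¹ : ℚ) • ((∑ i, x i ^ (r : ℕ)) ^ 2 - ∑ i, x i ^ (2 * r : ℕ))

theorem evalVars_plethysmTwo {N : ℕ} (x : Fin N → R) (f : SymFun ℚ) :
    evalVars x (plethysmTwo f) = MvPolynomial.aeval (pairPowerSum x) f := by
  rw [← AlgHom.comp_apply]
  congr 1
  apply MvPolynomial.algHom_ext
  intro r
  simp [plethysmTwo, evalVars, powerSum, pairPowerSum]

theorem pairPowerSum_cons {N : ℕ} (x : Fin N → R) (t : R) :
    pairPowerSum (Fin.cons t x : Fin (N + 1) → R) =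
      pairPowerSum x + fun r : ℕ+ => t ^ (r : ℕ) * ∑ i, x i ^ (r : ℕ) := by
  funext r
  simp only [pairPowerSum, Fin.sum_univ_succ, Fin.cons_zero, Fin.cons_succ, Pi.add_apply]
  have h : t ^ (r : ℕ) * ∑ i, x i ^ (r : ℕ) =
      (2⁻¹ : ℚ) • (2 * (t ^ (r : ℕ) * ∑ i, x i ^ (r : ℕ))) := by
    rw [two_mul, ← two_smul ℚ (t ^ (r : ℕ) * _), smul_smul]
    norm_num
  rw [h, ← smul_add]
  congr 1
  rw [mul_comm 2 (r : ℕ), pow_mul]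
  ring

theorem aeval_of_isEmpty {f : SymFun ℚ} {n : ℤ} (hn : n ≠ 0)
    (hf : MvPolynomial.IsWeightedHomogeneous degreeWeight f n) (x : Fin 0 → R) :
    evalVars x f = 0 := by
  have h : (fun r : ℕ+ => ∑ i : Fin 0, x i ^ (r : ℕ)) = fun _ => (0 : R) := by simp
  rw [evalVars, h]
  have h0 : MvPolynomial.constantCoeff f = 0 := by
    rw [MvPolynomial.constantCoeff_eq]
    exact hf.coeff_eq_zero 0 (by simpa using hn.symm)
  simp [MvPolynomial.aeval_def, h0]

theorem schur_of_card_eq_zero {μ : YoungDiagram} (h : μ.card = 0) : schur ℚ μ = 1 := by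
  have := μ.colLen_zero_le_card
  rw [schur_eq_jacobiTrudi μ (n := 0) (by omega), jacobiTrudi]
  simp

theorem homogeneous_sum_schur {n : ℕ} (s : Finset YoungDiagram) (hs : ∀ μ ∈ s, μ.card = n) :
    MvPolynomial.IsWeightedHomogeneous degreeWeight (∑ μ ∈ s, schur ℚ μ) (n : ℤ) := by
  refine (MvPolynomial.weightedHomogeneousSubmodule ℚ degreeWeight (n : ℤ)).sum_mem
      fun lam hlam => ?_
  rw [← hs lam hlam]
  exact homogeneous_schur lam

theorem evalVars_plethysmTwo_complete {N : ℕ} (x : Fin N → R) (n : ℕ) :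
    evalVars x (plethysmTwo (complete ℚ n)) =
      ∑ ν ∈ evenPartitionsOf (2 * n), evalVars x (schur ℚ ν) := by
  classical
  induction N generalizing n with
  | zero =>
    rcases n with _ | n
    · have : evenPartitionsOf (2 * 0) = {⊥} := by
        ext ν
        rw [mem_evenPartitionsOf, Finset.mem_singleton]
        constructor
        · rintro ⟨h, _⟩
          apply YoungDiagram.ext
          rw [cells_bot, ← Finset.card_eq_zero]
          exact h
        · rintro rfl
          exact ⟨rfl, isEven_iff.2 fun i => by simp [rowLen]⟩
      rw [this, Finset.sum_singleton, schur_of_card_eq_zero rfl, complete, map_one]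
    · have h : (2 * ((n + 1 : ℕ) : ℤ)) ≠ 0 := by positivity
      rw [aeval_of_isEmpty h (homogeneous_plethysmTwo (homogeneous_complete _)), ← map_sum]
      symm
      apply aeval_of_isEmpty h
      have := homogeneous_sum_schur (evenPartitionsOf (2 * (n + 1)))
        (fun μ hμ => (mem_evenPartitionsOf.1 hμ).1)
      push_cast at this ⊢
      exact this
  | succ N ih =>
    obtain ⟨t, y, rfl⟩ : ∃ t y, x = Fin.cons t y := ⟨x 0, Fin.tail x, (Fin.cons_self_tail x).symm⟩
    have hL : ∀ ν ∈ evenPartitionsOf (2 * n),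
        evalVars (Fin.cons t y : Fin (N + 1) → R) (schur ℚ ν) =
        ∑ μ ∈ upTo (2 * n), if ν = pairRows μ 0 then
          t ^ (2 * n - μ.card) * evalVars y (schur ℚ μ) else 0 := by
      intro ν hν
      rw [mem_evenPartitionsOf] at hν
      rw [evalVars_cons_schur y t ν (m := 2 * n) hν.1.le, Finset.sum_filter, hν.1]
      simp only [interlaces_even_iff hν.2]
    rw [Finset.sum_congr rfl hL, Finset.sum_comm]
    simp only [Finset.sum_ite_eq', mem_evenPartitionsOf, isEven_pairRows, and_true]
    rw [evalVars_plethysmTwo, ← coeff_completeSeries, pairPowerSum_cons, completeSeries_add,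
      completeSeries_smul t (fun r : ℕ+ => ∑ i, y i ^ (r : ℕ)), PowerSeries.coeff_mul]
    have hR : ∀ p : ℕ × ℕ, PowerSeries.coeff p.1 (completeSeries (pairPowerSum y)) *
        PowerSeries.coeff p.2 (PowerSeries.rescale t
          (completeSeries fun r : ℕ+ => ∑ i, y i ^ (r : ℕ))) =
        ∑ lam ∈ partitionsOf (2 * p.1 + p.2), if (pairRows lam 1).card = 2 * p.1 then
          t ^ p.2 * evalVars y (schur ℚ lam) else 0 := by
      rintro ⟨a, b⟩
      rw [coeff_completeSeries, PowerSeries.coeff_rescale, coeff_completeSeries,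
        ← evalVars_plethysmTwo, ih]
      change _ * (t ^ b * evalVars y (complete ℚ b)) = _
      rw [Finset.sum_mul]
      have h1 : ∀ ν ∈ evenPartitionsOf (2 * a),
          evalVars y (schur ℚ ν) * (t ^ b * evalVars y (complete ℚ b)) =
          ∑ lam ∈ partitionsOf (2 * a + b), if ν = pairRows lam 1 then
            t ^ b * evalVars y (schur ℚ lam) else 0 := by
        intro ν hν
        rw [mem_evenPartitionsOf] at hν
        rw [mul_left_comm, mul_comm (evalVars y (schur ℚ ν)), ← map_mul, complete_mul_schur,
          Finset.sum_filter, hν.1, map_sum, Finset.mul_sum]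
        refine Finset.sum_congr rfl fun lam _ => ?_
        simp only [even_interlaces_iff hν.2]
        split_ifs <;> simp
      rw [Finset.sum_congr rfl h1, Finset.sum_comm]
      simp only [Finset.sum_ite_eq', mem_evenPartitionsOf, isEven_pairRows, and_true]
    rw [Finset.sum_congr rfl fun p _ => hR p]
    simp only [← Finset.sum_filter]
    rw [Finset.sum_sigma']
    symm
    refine Finset.sum_bij' (fun μ _ => ⟨(μ.card - n, 2 * n - μ.card), μ⟩) (fun q _ => q.2)
      ?_ ?_ ?_ ?_ ?_
    · intro μ hμ
      rw [Finset.mem_filter, mem_upTo] at hμ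
      have := card_pairRows_add μ
      rw [Finset.mem_sigma, Finset.mem_filter, mem_partitionsOf,
        Finset.HasAntidiagonal.mem_antidiagonal]
      simp only
      omega
    · rintro ⟨⟨a, b⟩, μ⟩ hμ
      rw [Finset.mem_sigma, Finset.mem_filter, mem_partitionsOf,
        Finset.HasAntidiagonal.mem_antidiagonal] at hμ
      have := card_pairRows_add μ
      rw [Finset.mem_filter, mem_upTo]
      simp only at hμ ⊢
      omega
    · intro μ hμ
      rfl
    · rintro ⟨⟨a, b⟩, μ⟩ hμ
      rw [Finset.mem_sigma, Finset.mem_filter, mem_partitionsOf,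
        Finset.HasAntidiagonal.mem_antidiagonal] at hμ
      simp only at hμ
      have h1 : μ.card - n = a := by omega
      have h2 : 2 * n - μ.card = b := by omega
      simp only [h1, h2]
    · intro μ hμ
      rfl

theorem plethysmTwo_complete (n : ℕ) :
    plethysmTwo (complete ℚ n) = ∑ ν ∈ evenPartitionsOf (2 * n), schur ℚ ν := by
  apply evalX_eq_of_homogeneous (n := 2 * n) le_rfl
  · push_cast
    exact homogeneous_plethysmTwo (homogeneous_complete n)
  · exact homogeneous_sum_schur _ fun μ hμ => (mem_evenPartitionsOf.1 hμ).1
  · rw [map_sum, evalX, evalVars_plethysmTwo_complete]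

end SymFun

theorem Equiv.Perm.card_filter_lt {N : ℕ} (σ : Equiv.Perm (Fin N)) (a : Fin N) :
    (Finset.univ.filter fun j => σ j < a).card = a := by
  rw [← Fin.card_Iio a]
  refine Finset.card_bij (fun j _ => σ j) ?_ (fun j _ k _ h => σ.injective h) ?_
  · intro j hj
    simpa using hj
  · intro b hb
    exact ⟨σ.symm b, by simpa using hb, by simp⟩

namespace YoungDiagram

/-- The distance of row `i` from the diagonal. -/
def diagDist (ρ : YoungDiagram) (i : ℕ) : ℕ := (ρ.rowLen i - i) + (i - ρ.rowLen i)

theorem exists_perm_of_isThreshold {ρ : YoungDiagram} (hρ : IsThreshold ρ) {N : ℕ}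
    (hN : ρ.colLen 0 ≤ N) : ∃ σ : Equiv.Perm (Fin N), ∀ i, (σ i : ℕ) = diagDist ρ i := by
  have hlt : ∀ i : Fin N, diagDist ρ i < N := by
    intro i
    have hi := i.2
    by_cases h : (i : ℕ) < ρ.rowLen i
    · have h1 := hρ i (mem_iff_lt_rowLen.2 h)
      have h2 := ρ.colLen_anti 0 i (by omega)
      simp only [diagDist]
      omega
    · simp only [diagDist]
      omega
  have hne : ∀ i j : Fin N, i < j → diagDist ρ i ≠ diagDist ρ j := by
    intro i j hij h
    have hij' : (i : ℕ) < j := hij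
    have hanti := ρ.rowLen_anti i j hij'.le
    simp only [diagDist] at h
    by_cases hi : (i : ℕ) < ρ.rowLen i
    · have h1 := hρ i (mem_iff_lt_rowLen.2 hi)
      have h2 := lt_colLen_iff (μ := ρ) (i := j) (j := i)
      omega
    · omega
  have hinj : Function.Injective fun i : Fin N => (⟨diagDist ρ i, hlt i⟩ : Fin N) := by
    intro i j h
    have h' : diagDist ρ i = diagDist ρ j := congrArg Fin.val h
    rcases lt_trichotomy i j with hij | hij | hij
    · exact absurd h' (hne i j hij)
    · exact hij
    · exact absurd h'.symm (hne j i hij)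
  exact ⟨Equiv.ofBijective _ (Finite.injective_iff_bijective.1 hinj), fun i => rfl⟩

theorem isThreshold_of_perm {ρ : YoungDiagram} {N : ℕ} (hN : ρ.colLen 0 ≤ N)
    (σ : Equiv.Perm (Fin N)) (hσ : ∀ i, (σ i : ℕ) = diagDist ρ i) : IsThreshold ρ := by
  intro i hi
  rw [mem_iff_lt_rowLen] at hi
  have hiN : i < N := by
    by_contra h
    have := rowLen_eq_zero_iff.2 (hN.trans (not_lt.1 h))
    omega
  set s := ρ.rowLen i - i with hs
  have hσi : (σ ⟨i, hiN⟩ : ℕ) = s := by rw [hσ, diagDist]; simp only; omega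
  set P : Finset ℕ := (Finset.univ.filter fun j => σ j < σ ⟨i, hiN⟩).map Fin.valEmbedding with hP
  have hPcard : P.card = s := by rw [hP, Finset.card_map, σ.card_filter_lt, hσi]
  have hmem : ∀ j, j ∈ P ↔ j < N ∧ diagDist ρ j < s := by
    intro j
    rw [hP, Finset.mem_map]
    constructor
    · rintro ⟨k, hk, rfl⟩
      simp only [Finset.mem_filter, Finset.mem_univ, true_and, Fin.lt_def, hσ k, hσi] at hk
      exact ⟨k.2, hk⟩
    · rintro ⟨h1, h2⟩
      refine ⟨⟨j, h1⟩, ?_, rfl⟩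
      simp only [Finset.mem_filter, Finset.mem_univ, true_and, Fin.lt_def, hσi]
      rw [hσ]
      exact h2
  have hgt : ∀ j ∈ P, i < j := by
    intro j hj
    have h := ((hmem j).1 hj).2
    by_contra hc
    have := ρ.rowLen_anti j i (not_lt.1 hc)
    simp only [diagDist] at h
    omega
  have hclosed : ∀ j ∈ P, Finset.Ioc i j ⊆ P := by
    intro j hj k hk
    rw [Finset.mem_Ioc] at hk
    have h := (hmem j).1 hj
    rw [hmem]
    have h1 := ρ.rowLen_anti i k hk.1.le
    have h2 := ρ.rowLen_anti k j hk.2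
    simp only [diagDist] at h ⊢
    omega
  have hsub : P ⊆ Finset.Ioc i (i + s) := by
    intro j hj
    have h1 := Finset.card_le_card (hclosed j hj)
    rw [Nat.card_Ioc, hPcard] at h1
    have := hgt j hj
    rw [Finset.mem_Ioc]
    omega
  have heq : P = Finset.Ioc i (i + s) :=
    Finset.eq_of_subset_of_card_le hsub (by rw [Nat.card_Ioc, hPcard]; omega)
  have h1 : i + s ∈ P := by rw [heq, Finset.mem_Ioc]; omega
  have h2 : i + s + 1 ∉ P := by rw [heq, Finset.mem_Ioc]; omega
  have h3 : i < ρ.rowLen (i + s) := by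
    have := ((hmem _).1 h1).2
    simp only [diagDist] at this
    omega
  have h4 : ρ.rowLen (i + s + 1) ≤ i := by
    by_cases hlt : i + s + 1 < N
    · have h5 : ¬ diagDist ρ (i + s + 1) < s := fun h => h2 ((hmem _).2 ⟨hlt, h⟩)
      have h6 : diagDist ρ (i + s + 1) ≠ s := by
        intro h
        have h7 : σ ⟨i + s + 1, hlt⟩ = σ ⟨i, hiN⟩ := by
          apply Fin.ext
          rw [hσi, hσ]
          exact h
        have h8 := congrArg Fin.val (σ.injective h7)
        simp only at h8
        omega
      have h7 := ρ.rowLen_anti i (i + s + 1) (by omega)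
      simp only [diagDist] at h5 h6
      omega
    · rw [rowLen_eq_zero_iff.2 (by omega)]
      omega
  rw [← lt_colLen_iff] at h3
  rw [← not_lt, ← lt_colLen_iff] at h4
  omega

theorem sign_perm_diagDist {ρ : YoungDiagram} {N : ℕ} (σ : Equiv.Perm (Fin N))
    (hσ : ∀ i, (σ i : ℕ) = diagDist ρ i) :
    Equiv.Perm.sign σ = (-1) ^ ∑ i : Fin N, (ρ.rowLen i - i) := by
  rw [σ.sign_eq_prod_prod_Ioi, ← Finset.prod_pow_eq_pow_sum]
  refine Finset.prod_congr rfl fun i _ => ?_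
  have h1 : ∀ j ∈ Finset.Ioi i, (if σ i < σ j then 1 else -1 : ℤˣ) =
      if σ j < σ i then -1 else 1 := by
    intro j hj
    have hne : σ i ≠ σ j := fun h => (Finset.mem_Ioi.1 hj).ne (σ.injective h)
    rcases lt_or_gt_of_ne hne with h | h
    · rw [if_pos h, if_neg h.not_gt]
    · rw [if_neg h.not_gt, if_pos h]
  rw [Finset.prod_congr rfl h1, ← Finset.prod_filter, Finset.prod_const]
  congr 1
  by_cases hi : (i : ℕ) < ρ.rowLen i
  · have h2 : ((Finset.Ioi i).filter fun j => σ j < σ i) =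
        Finset.univ.filter fun j => σ j < σ i := by
      ext j
      simp only [Finset.mem_filter, Finset.mem_Ioi, Finset.mem_univ, true_and, and_iff_right_iff_imp]
      intro h
      rw [Fin.lt_def, hσ, hσ] at h
      by_contra hc
      have hc' : (j : ℕ) ≤ i := not_lt.1 hc
      have := ρ.rowLen_anti j i hc'
      simp only [diagDist] at h
      omega
    rw [h2, σ.card_filter_lt, hσ, diagDist]
    omega
  · rw [Finset.filter_false_of_mem, Finset.card_empty]
    · omega
    · intro j hj h
      rw [Finset.mem_Ioi, Fin.lt_def] at hj
      rw [Fin.lt_def, hσ, hσ] at h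
      have := ρ.rowLen_anti i j hj.le
      simp only [diagDist] at h
      omega

theorem card_eq_two_mul_of_perm {ρ : YoungDiagram} {N : ℕ} (hN : ρ.colLen 0 ≤ N)
    (σ : Equiv.Perm (Fin N)) (hσ : ∀ i, (σ i : ℕ) = diagDist ρ i) :
    ρ.card = 2 * ∑ i : Fin N, (ρ.rowLen i - i) := by
  have h1 : ∑ i, (σ i : ℕ) = ∑ i : Fin N, (i : ℕ) := Equiv.sum_comp σ (fun i => (i : ℕ))
  have h2 : ρ.card + ∑ i, (σ i : ℕ) = ∑ i : Fin N, (i : ℕ) + 2 * ∑ i : Fin N, (ρ.rowLen i - i) := by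
    rw [card_eq_sum_fin ρ hN, Finset.mul_sum, ← Finset.sum_add_distrib, ← Finset.sum_add_distrib]
    refine Finset.sum_congr rfl fun i _ => ?_
    rw [hσ, diagDist]
    omega
  omega

theorem mem_thresholdPartitionsOf {n : ℕ} {ν : YoungDiagram} :
    ν ∈ thresholdPartitionsOf n ↔ ν.card = n ∧ IsThreshold ν := by
  classical
  simp [thresholdPartitionsOf, mem_partitionsOf]

end YoungDiagram

namespace SymFun
open YoungDiagram

/-- The `k`-th folded power `x^(M-k) + (-z)^k x^(M+k)`, which is `x^M` for `k = 0`. -/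
def foldedPower {A : Type*} [CommRing A] (z x : A) (M k : ℕ) : A :=
  ∑ b ∈ ({M - k, M + k} : Finset ℕ), (-z) ^ (b - M) * x ^ b

theorem foldedPower_zero {A : Type*} [CommRing A] (z x : A) (M : ℕ) :
    foldedPower z x M 0 = x ^ M := by
  simp [foldedPower]

theorem foldedPower_of_pos {A : Type*} [CommRing A] (z x : A) (M k : ℕ) (hk : 0 < k) :
    foldedPower z x M k = x ^ (M - k) + (-z) ^ k * x ^ (M + k) := by
  rw [foldedPower, Finset.sum_pair (by omega), Nat.sub_eq_zero_of_le (Nat.sub_le M k),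
    Nat.add_sub_cancel_left]
  ring

theorem mul_foldedPower {A : Type*} [CommRing A] (z : A) (k : ℕ) :
    ∃ c : A, (k = 0 → c = 0) ∧ ∀ x M, k + 1 ≤ M → (1 - z * x ^ 2) * foldedPower z x (M - 1) k =
      foldedPower z x M (k + 1) + c * foldedPower z x M (k - 1) := by
  rcases k with _ | _ | k
  · refine ⟨0, fun _ => rfl, fun x M hM => ?_⟩
    obtain ⟨M, rfl⟩ := Nat.exists_eq_add_of_le' hM
    rw [foldedPower_zero, foldedPower_of_pos _ _ _ _ (by omega)]
    simp only [zero_add, Nat.add_sub_cancel]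
    ring
  · refine ⟨-2 * z, by simp, fun x M hM => ?_⟩
    obtain ⟨M, rfl⟩ := Nat.exists_eq_add_of_le' hM
    rw [foldedPower_of_pos _ _ _ _ (by omega), foldedPower_of_pos _ _ _ _ (by omega)]
    simp only [zero_add, Nat.reduceAdd, Nat.add_sub_cancel, Nat.sub_self, foldedPower_zero]
    have h1 : M + 2 - 1 - 1 = M := by omega
    have h2 : M + 2 - 1 + 1 = M + 2 := by omega
    rw [h1, h2]
    ring
  · refine ⟨-z, by simp, fun x M hM => ?_⟩
    obtain ⟨M, rfl⟩ := Nat.exists_eq_add_of_le' hM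
    rw [foldedPower_of_pos _ _ _ _ (by omega), foldedPower_of_pos _ _ _ _ (by omega),
      foldedPower_of_pos _ _ _ _ (by omega)]
    have h1 : M + (k + 1 + 1 + 1) - 1 - (k + 1 + 1) = M := by omega
    have h2 : M + (k + 1 + 1 + 1) - 1 + (k + 1 + 1) = M + 2 * k + 4 := by omega
    have h3 : M + (k + 1 + 1 + 1) - (k + 1 + 1 - 1) = M + 2 := by omega
    have h4 : k + 1 + 1 - 1 = k + 1 := by omega
    rw [h1, h2, h3, h4, Nat.add_sub_cancel]
    ring

theorem exists_coeff_foldedPower {A : Type*} [CommRing A] (z : A) (j : ℕ) :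
    ∃ c : ℕ → A, c j = 1 ∧ (∀ k, j < k → c k = 0) ∧ ∀ x M, j ≤ M →
      (1 - z * x ^ 2) ^ j * x ^ (M - j) =
        ∑ k ∈ Finset.range (j + 1), c k * foldedPower z x M k := by
  induction j with
  | zero =>
    refine ⟨fun k => if k = 0 then 1 else 0, by simp, fun k hk => if_neg hk.ne', fun x M _ => ?_⟩
    simp [foldedPower_zero]
  | succ j ih =>
    obtain ⟨c, hc, hc0, h⟩ := ih
    choose d hd0 hd using mul_foldedPower z
    refine ⟨fun k => (if k = 0 then 0 else c (k - 1)) + c (k + 1) * d (k + 1), ?_, ?_, ?_⟩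
    · simp [hc, hc0 (j + 1 + 1) (by omega)]
    · intro k hk
      simp only
      rw [if_neg (by omega), hc0 (k - 1) (by omega), hc0 (k + 1) (by omega)]
      simp
    · intro x M hM
      have h1 := h x (M - 1) (by omega)
      have h2 : M - (j + 1) = M - 1 - j := by omega
      rw [h2, pow_succ', mul_assoc, h1, Finset.mul_sum]
      have h3 : ∀ k ∈ Finset.range (j + 1), (1 - z * x ^ 2) * (c k * foldedPower z x (M - 1) k) =
          c k * foldedPower z x M (k + 1) + c k * d k * foldedPower z x M (k - 1) := by
        intro k hk
        rw [Finset.mem_range] at hk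
        rw [mul_left_comm, hd k x M (by omega)]
        ring
      rw [Finset.sum_congr rfl h3, Finset.sum_add_distrib]
      simp only [add_mul, Finset.sum_add_distrib]
      congr 1
      · rw [Finset.sum_range_succ' _ (j + 1)]
        simp
      · rw [Finset.sum_range_succ', Finset.sum_range_succ, Finset.sum_range_succ, hd0 0 rfl,
          hc0 (j + 1) (by omega), hc0 (j + 1 + 1) (by omega)]
        simp

variable {R : Type*} [CommRing R]

theorem det_foldedPower {A : Type*} [CommRing A] {N : ℕ} (z : A) (x : Fin N → A) :
    ∏ i : Fin N, ∏ j ∈ Finset.Ioi i, ((x i - x j) * (1 + z * (x i * x j))) =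
      Matrix.det (Matrix.of fun j i : Fin N => foldedPower z (x i) (N - 1) j) := by
  have h := Matrix.det_projVandermonde (fun i => 1 - z * x i ^ 2) x
  have h1 : ∏ i : Fin N, ∏ j ∈ Finset.Ioi i, ((x i - x j) * (1 + z * (x i * x j))) =
      (Matrix.projVandermonde (fun i => 1 - z * x i ^ 2) x).det := by
    rw [h]
    refine Finset.prod_congr rfl fun i _ => Finset.prod_congr rfl fun j _ => ?_
    ring
  rw [h1]
  choose c hc1 hc0 hc using exists_coeff_foldedPower z
  have h2 : Matrix.projVandermonde (fun i => 1 - z * x i ^ 2) x =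
      (Matrix.of fun j i : Fin N => foldedPower z (x i) (N - 1) j).transpose *
        Matrix.of fun k j : Fin N => c j k := by
    ext i j
    rw [Matrix.projVandermonde_apply, Matrix.mul_apply, Fin.val_rev]
    have hj := j.2
    have h3 : N - ((j : ℕ) + 1) = N - 1 - j := by omega
    rw [h3, hc j (x i) (N - 1) (by omega)]
    simp only [Matrix.transpose_apply, Matrix.of_apply]
    rw [← Finset.sum_range (fun k => foldedPower z (x i) (N - 1) k * c j k)]
    have h4 : Finset.range ((j : ℕ) + 1) ⊆ Finset.range N := by
      intro k; simp only [Finset.mem_range]; omega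
    rw [Finset.sum_subset h4]
    · exact Finset.sum_congr rfl fun k _ => mul_comm _ _
    · intro k _ hk
      rw [Finset.mem_range] at hk
      rw [hc0 j k (by omega), zero_mul]
  have h5 : (Matrix.of fun k j : Fin N => c j k).det = 1 := by
    rw [Matrix.det_of_isUpperTriangular]
    · exact Finset.prod_eq_one fun i _ => hc1 i
    · intro i j hij
      exact hc0 _ _ hij
  rw [h2, Matrix.det_mul, Matrix.det_transpose, h5, mul_one]

theorem prod_mul_alternant {N : ℕ} (x : Fin N → R) (n : ℕ) :
    PowerSeries.coeff n (∏ i : Fin N, ∏ j ∈ Finset.Ioi i,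
        (1 + PowerSeries.C (x i * x j) * PowerSeries.X)) * alternant x (shifted N 0) =
      ∑ p ∈ (Fintype.piFinset fun j : Fin N => ({N - 1 - j, N - 1 + j} : Finset ℕ)) with
        ∑ j, (p j - (N - 1)) = n, (-1) ^ n * alternant x p := by
  have h1 := det_foldedPower (PowerSeries.X : PowerSeries R) (fun i => PowerSeries.C (x i))
  have h2 : (∏ i : Fin N, ∏ j ∈ Finset.Ioi i,
        (1 + PowerSeries.C (x i * x j) * PowerSeries.X)) *
          PowerSeries.C (alternant x (shifted N 0)) =
      ∏ i : Fin N, ∏ j ∈ Finset.Ioi i, ((PowerSeries.C (x i) - PowerSeries.C (x j)) *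
        (1 + PowerSeries.X * (PowerSeries.C (x i) * PowerSeries.C (x j)))) := by
    rw [alternant_staircase, map_prod, ← Finset.prod_mul_distrib]
    refine Finset.prod_congr rfl fun i _ => ?_
    rw [map_prod, ← Finset.prod_mul_distrib]
    refine Finset.prod_congr rfl fun j _ => ?_
    rw [map_sub, map_mul]
    ring
  have h3 := congrArg (PowerSeries.coeff n) (h2.trans h1)
  rw [PowerSeries.coeff_mul_C] at h3
  rw [h3]
  simp only [foldedPower]
  rw [Matrix.det_sum_smul_rows (fun j : Fin N => ({N - 1 - j, N - 1 + j} : Finset ℕ))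
    (fun _ b => (-PowerSeries.X) ^ (b - (N - 1))) (fun _ b i => PowerSeries.C (x i) ^ b), map_sum,
    Finset.sum_filter]
  refine Finset.sum_congr rfl fun p _ => ?_
  have h4 : Matrix.det (Matrix.of fun i : Fin N => fun i_1 => PowerSeries.C (x i_1) ^ p i) =
      PowerSeries.C (alternant x p) := by
    rw [alternant, RingHom.map_det]
    congr 1
    ext i j : 2
    simp
  rw [h4, Finset.prod_pow_eq_pow_sum, neg_pow, mul_assoc, ← map_one (PowerSeries.C (R := R)),
    ← map_neg, ← map_pow, PowerSeries.coeff_C_mul, PowerSeries.coeff_X_pow_mul',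
    PowerSeries.coeff_C]
  by_cases h : ∑ j, (p j - (N - 1)) = n
  · simp [h]
  · rw [if_neg h]
    split_ifs
    · omega
    · simp
    · simp

theorem prod_mul_alternant_eq_threshold {N : ℕ} (x : Fin N → R) {n : ℕ} (hN : 2 * n ≤ N) :
    PowerSeries.coeff n (∏ i : Fin N, ∏ j ∈ Finset.Ioi i,
        (1 + PowerSeries.C (x i * x j) * PowerSeries.X)) * alternant x (shifted N 0) =
      ∑ ρ ∈ thresholdPartitionsOf (2 * n), alternant x (shifted N ρ.rowLen) := by
  rw [prod_mul_alternant]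
  symm
  have hlen : ∀ ρ ∈ thresholdPartitionsOf (2 * n), ρ.colLen 0 ≤ N := by
    intro ρ hρ
    rw [mem_thresholdPartitionsOf] at hρ
    have := ρ.colLen_zero_le_card
    omega
  have hex : ∀ ρ : YoungDiagram, ∃ σ : Equiv.Perm (Fin N),
      ρ ∈ thresholdPartitionsOf (2 * n) → ∀ i, (σ i : ℕ) = diagDist ρ i := by
    intro ρ
    by_cases hρ : ρ ∈ thresholdPartitionsOf (2 * n)
    · obtain ⟨σ, hσ⟩ := exists_perm_of_isThreshold (mem_thresholdPartitionsOf.1 hρ).2 (hlen ρ hρ)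
      exact ⟨σ, fun _ => hσ⟩
    · exact ⟨1, fun h => absurd h hρ⟩
  choose σ hσ using hex
  have hsum : ∀ ρ ∈ thresholdPartitionsOf (2 * n), ∑ i : Fin N, (ρ.rowLen i - i) = n := by
    intro ρ hρ
    have h1 := card_eq_two_mul_of_perm (hlen ρ hρ) (σ ρ) (hσ ρ hρ)
    rw [(mem_thresholdPartitionsOf.1 hρ).1] at h1
    omega
  refine Finset.sum_bij (fun ρ _ j => shifted N ρ.rowLen ((σ ρ).symm j)) ?_ ?_ ?_ ?_
  · intro ρ hρ
    rw [Finset.mem_filter, Fintype.mem_piFinset]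
    constructor
    · intro j
      obtain ⟨i, rfl⟩ := (σ ρ).surjective j
      have h1 := hσ ρ hρ i
      have := i.2
      rw [Equiv.symm_apply_apply, Finset.mem_insert, Finset.mem_singleton, h1, diagDist, shifted]
      omega
    · rw [Equiv.sum_comp (σ ρ).symm (fun i => shifted N ρ.rowLen i - (N - 1)), ← hsum ρ hρ]
      refine Finset.sum_congr rfl fun i _ => ?_
      have := i.2
      rw [shifted]
      omega
  · intro ρ hρ τ hτ h
    apply shifted_rowLen_inj (hlen ρ hρ) (hlen τ hτ)
    rw [← (strictAnti_shifted N ρ.rowLen_anti).range_inj (strictAnti_shifted N τ.rowLen_anti)]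
    exact ((σ ρ).symm.surjective.range_comp (shifted N ρ.rowLen)).symm.trans
      ((congrArg Set.range h).trans ((σ τ).symm.surjective.range_comp (shifted N τ.rowLen)))
  · intro p hp
    rw [Finset.mem_filter, Fintype.mem_piFinset] at hp
    obtain ⟨hp, hpn⟩ := hp
    have hp' : ∀ j : Fin N, p j = N - 1 - j ∨ p j = N - 1 + j := by
      intro j
      have := hp j
      rwa [Finset.mem_insert, Finset.mem_singleton] at this
    have hinj : Function.Injective p := by
      intro i j hij
      apply Fin.ext
      have := hp' i
      have := hp' j
      have := i.2
      have := j.2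
      omega
    let τ : Equiv.Perm (Fin N) := Fin.revPerm.trans (Tuple.sort p)
    have hanti : StrictAnti (p ∘ τ) := by
      have h1 : Antitone (p ∘ τ) := by
        intro i j hij
        exact Tuple.monotone_sort p (Fin.rev_le_rev.2 hij)
      exact h1.strictAnti_of_injective (hinj.comp τ.injective)
    have hge : ∀ d : ℕ, ∀ i : Fin N, N - 1 - i = d → d ≤ p (τ i) := by
      intro d
      induction d with
      | zero => intro i _; omega
      | succ d ih =>
        intro i hi
        have h1 := ih ⟨i + 1, by omega⟩ (by simp only; omega)
        have h2 := hanti (show i < ⟨i + 1, by omega⟩ by rw [Fin.lt_def]; simp)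
        simp only [Function.comp_apply] at h2
        omega
    have hgap : ∀ d : ℕ, ∀ i j : Fin N, (j : ℕ) = i + d → p (τ j) + d ≤ p (τ i) := by
      intro d
      induction d with
      | zero =>
        intro i j hij
        have : i = j := Fin.ext (by omega)
        rw [this]; omega
      | succ d ih =>
        intro i j hij
        have hj := j.2
        have h1 := ih i ⟨i + d, by omega⟩ rfl
        have h2 := hanti (show (⟨i + d, by omega⟩ : Fin N) < j by rw [Fin.lt_def]; simp only; omega)
        simp only [Function.comp_apply] at h2
        omega
    obtain ⟨ρ, h1, h2⟩ := exists_rowLen_eq (fun i : Fin N => p (τ i) - (N - 1 - i)) (by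
      intro i j hij
      have hij' : (i : ℕ) ≤ j := hij
      have h1 := hgap (j - i) i j (by omega)
      have := j.2
      have := hge _ j rfl
      show p (τ j) - (N - 1 - j) ≤ p (τ i) - (N - 1 - i)
      omega)
    have hshift : shifted N ρ.rowLen = p ∘ τ := by
      funext i
      have := hge _ i rfl
      rw [shifted, h1, Function.comp_apply]
      omega
    have hlenρ : ρ.colLen 0 ≤ N := rowLen_eq_zero_iff.1 (h2 N le_rfl)
    have hτ : ∀ i, (τ i : ℕ) = diagDist ρ i := by
      intro i
      have h3 := congrFun hshift i
      rw [Function.comp_apply, shifted] at h3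
      have := hp' (τ i)
      have := i.2
      have := (τ i).2
      rw [diagDist]
      omega
    have hρ : ρ ∈ thresholdPartitionsOf (2 * n) := by
      rw [mem_thresholdPartitionsOf]
      refine ⟨?_, isThreshold_of_perm hlenρ τ hτ⟩
      rw [card_eq_two_mul_of_perm hlenρ τ hτ, ← hpn,
        ← Equiv.sum_comp τ (fun j => p j - (N - 1))]
      congr 1
      refine Finset.sum_congr rfl fun i _ => ?_
      have h3 := congrFun hshift i
      rw [Function.comp_apply, shifted] at h3
      have := i.2
      omega
    have hστ : σ ρ = τ := by
      ext i
      rw [hσ ρ hρ, hτ]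
    refine ⟨ρ, hρ, ?_⟩
    funext j
    rw [hστ, hshift, Function.comp_apply, Equiv.apply_symm_apply]
  · intro ρ hρ
    have h1 : alternant x (shifted N ρ.rowLen) = Equiv.Perm.sign (σ ρ) *
        alternant x (fun j => shifted N ρ.rowLen ((σ ρ).symm j)) := by
      rw [alternant, alternant, ← Matrix.det_permute]
      congr 1
      ext i j
      simp
    rw [h1, sign_perm_diagDist (σ ρ) (hσ ρ hρ), hsum ρ hρ]
    simp

theorem pairPowerSum_elementary [Algebra ℚ R] {N : ℕ} (x : Fin N → R) :
    completeSeries (fun r : ℕ+ => (-1) ^ ((r : ℕ) + 1) * pairPowerSum x r) =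
      ∏ i : Fin N, ∏ j ∈ Finset.Ioi i, (1 + PowerSeries.C (x i * x j) * PowerSeries.X) := by
  induction N with
  | zero =>
    have : (fun r : ℕ+ => (-1) ^ ((r : ℕ) + 1) * pairPowerSum x r) = 0 := by
      funext r
      simp [pairPowerSum]
    rw [this, completeSeries_zero]
    simp
  | succ N ih =>
    obtain ⟨t, y, rfl⟩ : ∃ t y, x = Fin.cons t y := ⟨x 0, Fin.tail x, (Fin.cons_self_tail x).symm⟩
    have h : (fun r : ℕ+ => (-1) ^ ((r : ℕ) + 1) *
        pairPowerSum (Fin.cons t y : Fin (N + 1) → R) r) =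
        (∑ i, fun r : ℕ+ => (-1) ^ ((r : ℕ) + 1) * (t * y i) ^ (r : ℕ)) +
        (fun r : ℕ+ => (-1) ^ ((r : ℕ) + 1) * pairPowerSum y r) := by
      funext r
      rw [pairPowerSum_cons]
      simp only [Pi.add_apply, Finset.sum_apply, mul_pow, Finset.mul_sum]
      rw [mul_add, add_comm, Finset.mul_sum]
    rw [h, completeSeries_add, completeSeries_sum, ih, Fin.prod_univ_succ, Fin.prod_Ioi_zero]
    simp only [completeSeries_pow_elementary, Fin.prod_Ioi_succ, Fin.cons_zero, Fin.cons_succ]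

theorem plethysmTwo_elementary (n : ℕ) :
    plethysmTwo (elementary n) = ∑ ρ ∈ thresholdPartitionsOf (2 * n), schur ℚ ρ := by
  apply evalX_eq_of_homogeneous (n := 2 * n) le_rfl
  · push_cast
    exact homogeneous_plethysmTwo (homogeneous_elementary n)
  · exact homogeneous_sum_schur _ fun μ hμ => (mem_thresholdPartitionsOf.1 hμ).1
  · apply mul_right_cancel₀ (alternant_X_ne_zero (2 * n))
    rw [evalX, evalVars_plethysmTwo, aeval_elementary, pairPowerSum_elementary,
      prod_mul_alternant_eq_threshold _ le_rfl, map_sum, Finset.sum_mul]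
    refine Finset.sum_congr rfl fun ρ hρ => ?_
    symm
    apply evalX_schur_mul
    rw [← (mem_thresholdPartitionsOf.1 hρ).1]
    exact ρ.colLen_zero_le_card

end SymFun

namespace SymFun
open YoungDiagram

theorem elementary_zero : elementary 0 = 1 := by rw [elementary, complete, map_one]

theorem rowLen_hook (a k : ℕ) (ha : 0 < a) (i : ℕ) :
    (hook a k ha).rowLen i = if i = 0 then a else if i ≤ k then 1 else 0 := by
  have hmem : ∀ j, j < (hook a k ha).rowLen i ↔
      j < if i = 0 then a else if i ≤ k then 1 else 0 := by
    intro j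
    rw [← mem_iff_lt_rowLen, hook, mem_ofRowLens]
    rcases i with _ | i
    · simp
    · simp only [List.length_cons, List.length_replicate, List.getElem_cons_succ,
        List.getElem_replicate, Nat.succ_ne_zero, if_false]
      split_ifs with hik
      · exact ⟨fun ⟨_, hj⟩ => hj, fun hj => ⟨by omega, hj⟩⟩
      · exact ⟨fun ⟨_, _⟩ => by omega, fun hj => by omega⟩
  have h1 := hmem ((hook a k ha).rowLen i)
  have h2 := hmem (if i = 0 then a else if i ≤ k then 1 else 0)
  omega

theorem schur_hook (a k : ℕ) (ha : 0 < a) :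
    schur ℚ (hook a k ha) =
      ∑ i ∈ Finset.range (k + 1), (-1) ^ i * (complete ℚ (a + i) * elementary (k - i)) := by
  have hlen : (hook a k ha).colLen 0 ≤ k + 1 := by
    rw [← rowLen_eq_zero_iff, rowLen_hook]
    simp
  rw [schur_eq_jacobiTrudi _ hlen, jacobiTrudi]
  set M : Matrix (Fin (k + 1)) (Fin (k + 1)) (SymFun ℚ) := Matrix.of fun i j =>
    completeInt ℚ (((hook a k ha).rowLen i : ℤ) - (i : ℤ) + (j : ℤ)) with hM
  set S := ∑ i ∈ Finset.range (k + 1), (-1) ^ i * (complete ℚ (a + i) * elementary (k - i)) with hS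
  let c : Fin (k + 1) → SymFun ℚ := fun j => (-1) ^ (j : ℕ) * elementary (k - j)
  have h0 : M.mulVec c 0 = S := by
    rw [hS, Finset.sum_range, Matrix.mulVec, dotProduct]
    refine Finset.sum_congr rfl fun j _ => ?_
    have : ((a : ℤ) - ((0 : ℕ) : ℤ) + (j : ℕ)) = ((a + j : ℕ) : ℤ) := by push_cast; ring
    simp only [hM, Matrix.of_apply, rowLen_hook, Fin.val_zero, if_true, c]
    rw [this, completeInt_natCast]
    ring
  have hsucc : ∀ i : Fin k, M.mulVec c i.succ = 0 := by
    intro i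
    have hi := i.2
    have h1 := sum_complete_mul_elementary (k - i) (by omega)
    rw [Finset.Nat.sum_antidiagonal_eq_sum_range_succ_mk] at h1
    let F : ℕ → SymFun ℚ := fun j =>
      completeInt ℚ ((j : ℤ) - (i : ℕ)) * ((-1) ^ j * elementary (k - j))
    have h2 : M.mulVec c i.succ = ∑ j ∈ Finset.range (k + 1), F j := by
      rw [Finset.sum_range, Matrix.mulVec, dotProduct]
      refine Finset.sum_congr rfl fun j _ => ?_
      simp only [hM, Matrix.of_apply, rowLen_hook, Fin.val_succ, c, F]
      rw [if_neg (by omega), if_pos (by omega)]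
      congr 2
      push_cast
      ring
    have h3 : Finset.range (k + 1) = Finset.range (i + (k - i + 1)) := by congr 1; omega
    rw [h2, h3, Finset.sum_range_add, Finset.sum_eq_zero, zero_add]
    · rw [← mul_zero ((-1) ^ k), ← h1, Finset.mul_sum]
      refine Finset.sum_congr rfl fun m hm => ?_
      rw [Finset.mem_range] at hm
      have h4 : (((i + m : ℕ) : ℤ) - (i : ℕ)) = (m : ℕ) := by push_cast; ring
      have h5 : k - (i + m) = k - i - m := by omega
      have h6 : ((-1) ^ k : SymFun ℚ) = (-1) ^ (i + m) * (-1) ^ (k - i - m) := by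
        rw [← pow_add]; congr 1; omega
      simp only [F]
      rw [h4, h5, completeInt_natCast, h6]
      have h7 : ((-1) ^ (k - i - m) * (-1) ^ (k - i - m) : SymFun ℚ) = 1 := by
        rw [← mul_pow]; simp
      linear_combination (-(complete ℚ m * (-1) ^ ((i : ℕ) + m) * elementary (k - i - m))) * h7
    · intro j hj
      rw [Finset.mem_range] at hj
      simp only [F]
      rw [completeInt_of_neg (by omega), zero_mul]
  have hminor : (M.submatrix (Fin.succAbove 0) (Fin.succAbove (Fin.last k))).det = 1 := by
    have hentry : ∀ i j : Fin k, M.submatrix (Fin.succAbove 0) (Fin.succAbove (Fin.last k)) i j =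
        completeInt ℚ ((j : ℤ) - (i : ℕ)) := by
      intro i j
      have := i.2
      simp only [hM, Matrix.submatrix_apply, Matrix.of_apply, rowLen_hook, Fin.zero_succAbove,
        Fin.succAbove_last, Fin.val_succ, Fin.val_castSucc]
      rw [if_neg (by omega), if_pos (by omega)]
      congr 1
      push_cast
      ring
    rw [Matrix.det_of_isUpperTriangular]
    · refine Finset.prod_eq_one fun i _ => ?_
      rw [hentry, sub_self]
      simp [completeInt, complete]
    · intro i j hij
      have hij' : (j : ℕ) < i := hij
      rw [hentry, completeInt_of_neg (by omega)]
  have h1 : (M.adjugate.mulVec (M.mulVec c)) (Fin.last k) = M.det * c (Fin.last k) := by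
    rw [Matrix.mulVec_mulVec, Matrix.adjugate_mul, Matrix.smul_mulVec, Matrix.one_mulVec]
    rfl
  rw [Matrix.mulVec, dotProduct, Fin.sum_univ_succ] at h1
  simp only [hsucc, mul_zero, Finset.sum_const_zero, add_zero] at h1
  rw [h0, Matrix.adjugate_fin_succ_eq_det_submatrix, hminor] at h1
  simp only [c, Fin.val_last, Nat.sub_self, elementary_zero, Fin.val_zero, zero_add, mul_one] at h1
  have h2 : ((-1) ^ k * (-1) ^ k : SymFun ℚ) = 1 := by rw [← mul_pow]; simp
  linear_combination (-(-1) ^ k) * h1 + (S - M.det) * h2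

theorem schur_columnTwo :
    schur ℚ columnTwo = (2⁻¹ : ℚ) • (powerSum ℚ 1 ^ 2 - powerSum ℚ 2) := by
  have h := schur_hook 1 1 Nat.one_pos
  have h1 : complete ℚ 1 = powerSum ℚ 1 := by
    simp [complete]
    rfl
  have h2 : complete ℚ 2 = (2⁻¹ : ℚ) • (powerSum ℚ 1 ^ 2 + powerSum ℚ 2) := by
    rw [complete, Fin.sum_univ_two]
    simp only [Fin.val_zero, Fin.val_one, Nat.sub_zero, Nat.sub_self, h1, complete]
    norm_num
    rw [pow_two]
    rfl
  have h3 : elementary 1 = powerSum ℚ 1 := by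
    rw [elementary, h1, powerSum, MvPolynomial.aeval_X]
    simp [powerSum]
  have h4 : powerSum ℚ 1 ^ 2 = (2⁻¹ : ℚ) • (powerSum ℚ 1 ^ 2 + powerSum ℚ 1 ^ 2) := by
    rw [← two_smul ℚ, smul_smul]; norm_num
  rw [Finset.sum_range_succ, Finset.sum_range_one] at h
  simp only [pow_zero, one_mul, add_zero, Nat.sub_zero, Nat.sub_self, h1, h3, pow_one,
    Nat.reduceAdd, h2, elementary_zero, mul_one, neg_one_mul] at h
  refine h.trans ?_
  rw [← pow_two, h4, ← smul_neg, ← smul_add, ← h4]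
  congr 1
  ring

theorem plethysm_map {K : Type*} [CommRing K] [Algebra ℚ K] (f : SymFun ℚ) :
    plethysm (MvPolynomial.map (algebraMap ℚ K) f) (schur ℚ columnTwo) =
      MvPolynomial.map (algebraMap ℚ K) (plethysmTwo f) := by
  induction f using MvPolynomial.induction_on with
  | C a =>
    rw [plethysm, plethysmTwo, MvPolynomial.map_C, MvPolynomial.aeval_C, MvPolynomial.aeval_C,
      MvPolynomial.algebraMap_eq, MvPolynomial.algebraMap_eq, MvPolynomial.map_C]
  | add p q hp hq =>
    rw [plethysm] at hp hq ⊢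
    rw [map_add, map_add, map_add, map_add, hp, hq]
  | mul_X p r hp =>
    rw [plethysm] at hp ⊢
    rw [map_mul, map_mul, map_mul, map_mul, hp, MvPolynomial.map_X, MvPolynomial.aeval_X]
    congr 1
    rw [plethysmTwo, MvPolynomial.aeval_X, powerSumPlethysm, schur_columnTwo]
    congr 1
    simp [powerSum, mul_comm r 2]

end SymFun

end

theorem mainTheorem6 {K : Type*} [CommRing K] [Algebra ℚ K] (h k : ℕ) (hk : k < h) :
    SymFun.plethysm (SymFun.schur K (YoungDiagram.hook (h - k) k (Nat.sub_pos_of_lt hk)))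
        (SymFun.schur ℚ YoungDiagram.columnTwo) =
      ∑ i ∈ Finset.range (k + 1),
        ∑ μ ∈ YoungDiagram.partitionsOf (2 * h),
          ∑ ν ∈ YoungDiagram.evenPartitionsOf (2 * (h - k + i)),
            ∑ ρ ∈ YoungDiagram.thresholdPartitionsOf (2 * (k - i)),
              ((-1) ^ i * SymFun.lrCoeff K μ ν ρ) • SymFun.schur K μ := by
  rw [← SymFun.map_schur, SymFun.plethysm_map, SymFun.schur_hook, map_sum, map_sum]
  refine Finset.sum_congr rfl fun i hi => ?_
  rw [Finset.mem_range] at hi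
  simp only [map_mul, map_pow, map_neg, map_one, SymFun.plethysmTwo_complete,
    SymFun.plethysmTwo_elementary, map_sum, SymFun.map_schur, Finset.sum_mul_sum]
  conv_rhs => rw [Finset.sum_comm]
  rw [Finset.mul_sum]
  refine Finset.sum_congr rfl fun ν hν => ?_
  conv_rhs => rw [Finset.sum_comm]
  rw [Finset.mul_sum]
  refine Finset.sum_congr rfl fun ρ hρ => ?_
  rw [← SymFun.sum_lrCoeff_smul_schur K ν ρ (n := 2 * h), Finset.mul_sum]
  · refine Finset.sum_congr rfl fun μ _ => ?_
    rw [mul_smul, Algebra.smul_def ((-1) ^ i : K)]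
    simp
  · rw [(YoungDiagram.mem_evenPartitionsOf.1 hν).1, (YoungDiagram.mem_thresholdPartitionsOf.1 hρ).1]
    omega
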